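/- Let $d\ge 2$ be an integer and let $c\ge 0$ be a constant with $c<\frac{1}{2^{2d+1}d}$. Let $X\sim X(n,c/n^{1/d})$ be the random flag complex, i.e. the clique complex of the Erdős–Rényi random graph $G(n,p)$ on $n$ vertices in which each edge is present independently with probability $p=c/n^{1/d}$. Then, with probability tending to $1$ as $n\to\infty$, $X$ is almost $d$-collapsible: there is a finite sequence of elementary collapses (each removing a face that is properly contained in exactly one other face, together with that other face) from $X$ to a simplicial complex $Y$ of dimension at most $d$ whose pure $d$-dimensional part (the subcomplex of $Y$ whose facets are the $d$-dimensional faces of $Y$) is a (possibly empty) face-disjoint union of copies of the boundary of the $(d+1)$-dimensional cross-polytope, i.e. a union of such copies no two of which share a $d$-dimensional face. Here the boundary of the $(d+1)$-dimensional cross-polytope is the clique complex of the complete $(d+1)$-partite graph with two vertices in each part. -/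

import Mathlib

open Filter Topology

namespace RandomFlag

variable {α : Type*}

/-- The clique (flag) complex of a graph: its faces are the nonempty finite cliques. -/
def cliqueComplex (G : SimpleGraph α) : PreAbstractSimplicialComplex α where
  faces := {s | s.Nonempty ∧ G.IsClique (s : Set α)}
  isRelLowerSet_faces := fun _ hs =>
    ⟨hs.1, fun _ hts ht => ⟨ht, hs.2.subset (Finset.coe_subset.2 hts)⟩⟩

/-- `σ` is a free face of `K` with unique coface `τ`: the face `τ` is the only face of `K` that
properly contains the face `σ`. -/
def IsFreeFace (K : PreAbstractSimplicialComplex α) (σ τ : Finset α) : Prop :=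
  σ ∈ K.faces ∧ τ ∈ K.faces ∧ σ ⊂ τ ∧ ∀ ρ ∈ K.faces, σ ⊂ ρ → ρ = τ

/-- `L` arises from `K` by one elementary collapse: a free face of `K` and its unique coface are
removed. -/
def ElementaryCollapse (K L : PreAbstractSimplicialComplex α) : Prop :=
  ∃ σ τ, IsFreeFace K σ τ ∧ L.faces = K.faces \ {σ, τ}

/-- `K` collapses to `L` by a finite (possibly empty) sequence of elementary collapses. -/
def CollapsesTo (K L : PreAbstractSimplicialComplex α) : Prop :=
  Relation.ReflTransGen ElementaryCollapse K L

/-- `K` has dimension at most `d`. (A face with `k + 1` vertices has dimension `k`.) -/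
def DimLE (d : ℕ) (K : PreAbstractSimplicialComplex α) : Prop :=
  ∀ s ∈ K.faces, s.card ≤ d + 1

/-- The pure `d`-dimensional part of `K`: the subcomplex whose facets are the `d`-dimensional
faces of `K`. -/
def purePart (d : ℕ) (K : PreAbstractSimplicialComplex α) : PreAbstractSimplicialComplex α where
  faces := {s | s.Nonempty ∧ ∃ t ∈ K.faces, t.card = d + 1 ∧ s ⊆ t}
  isRelLowerSet_faces := fun _ hs =>
    ⟨hs.1, fun _ hus hu => ⟨hu, hs.2.imp fun _ h => ⟨h.1, h.2.1, hus.trans h.2.2⟩⟩⟩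

/-- The boundary of the `(d + 1)`-dimensional cross-polytope: the clique complex of the complete
`(d + 1)`-partite graph with two vertices in each part. -/
def crossPolytopeBoundary (d : ℕ) : PreAbstractSimplicialComplex ((_ : Fin (d + 1)) × Fin 2) :=
  cliqueComplex (SimpleGraph.completeMultipartiteGraph fun _ : Fin (d + 1) => Fin 2)

/-- `C` is a copy of the boundary of the `(d + 1)`-dimensional cross-polytope: the image of the
latter under an injective relabelling of its vertices. -/
def IsCrossPolytopeBoundary [DecidableEq α] (d : ℕ) (C : PreAbstractSimplicialComplex α) : Prop :=
  ∃ v : ((_ : Fin (d + 1)) × Fin 2) → α,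
    Function.Injective v ∧ C = (crossPolytopeBoundary d).map v

/-- `K` is a face-disjoint union of boundaries of `(d + 1)`-dimensional cross-polytopes: it is the
union of a (possibly empty) set of such boundaries, no two of which share a `d`-dimensional
face. -/
def IsFaceDisjointUnion [DecidableEq α] (d : ℕ) (K : PreAbstractSimplicialComplex α) : Prop :=
  ∃ 𝒞 : Set (PreAbstractSimplicialComplex α),
    (∀ C ∈ 𝒞, IsCrossPolytopeBoundary d C) ∧
    (∀ C ∈ 𝒞, ∀ D ∈ 𝒞, C ≠ D → ∀ s ∈ C.faces, s ∈ D.faces → s.card ≠ d + 1) ∧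
    K.faces = ⋃ C ∈ 𝒞, C.faces

/-- `K` is almost `d`-collapsible: it collapses to a complex of dimension at most `d` whose pure
`d`-dimensional part is a face-disjoint union of boundaries of `(d + 1)`-cross-polytopes. -/
def AlmostCollapsible [DecidableEq α] (d : ℕ) (K : PreAbstractSimplicialComplex α) : Prop :=
  ∃ Y, CollapsesTo K Y ∧ DimLE d Y ∧ IsFaceDisjointUnion d (purePart d Y)

/-- The edge probability `c / n^(1/d)`, as an element of the unit interval. -/
noncomputable def edgeProb (d : ℕ) (c : ℝ) (n : ℕ) : unitInterval :=
  Set.projIcc 0 1 zero_le_one (c / (n : ℝ) ^ (1 / (d : ℝ)))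

/-- The projection to the unit interval in `edgeProb` changes nothing when `0 ≤ c ≤ 1`. -/
theorem coe_edgeProb (d : ℕ) {c : ℝ} (h0 : 0 ≤ c) (h1 : c ≤ 1) (n : ℕ) :
    (edgeProb d c n : ℝ) = c / (n : ℝ) ^ (1 / (d : ℝ)) := by
  have hmem : c / (n : ℝ) ^ (1 / (d : ℝ)) ∈ Set.Icc (0 : ℝ) 1 := by
    refine ⟨by positivity, ?_⟩
    rcases Nat.eq_zero_or_pos n with rfl | hn
    · by_cases hd : 1 / (d : ℝ) = 0
      · rw [hd, Real.rpow_zero, div_one]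
        exact h1
      · rw [Nat.cast_zero, Real.zero_rpow hd, div_zero]
        exact zero_le_one
    · have : (1 : ℝ) ≤ (n : ℝ) ^ (1 / (d : ℝ)) :=
        Real.one_le_rpow (by exact_mod_cast hn) (by positivity)
      exact div_le_one_of_le₀ (h1.trans this) (by positivity)
  rw [edgeProb, Set.projIcc_of_mem _ hmem]

end RandomFlag

/-! A deterministic statement is combined with a first moment estimate. Call a graph sparse
(`IsSparse`) if every strongly connected set of (d+1)-cliques, where consecutive cliques share d
vertices, induces a subgraph of average degree at most 2d.

Sparse graphs have almost d-collapsible clique complexes. A collapse of the link of v, coned with v,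
removes the top part of the star of v. By induction on dimension, a k-dimensional flag family with
at most 2k+2 vertices collapses below dimension k unless it is a cross-polytope boundary
(`isCollapsible_or_isCross`). If no vertex link in a strong component collapses, every link has at
least 2d vertices. Sparsity then forces all degrees to equal 2d, every link is a cross-polytope
filling the neighbourhood, and so the component is a cross-polytope (`isCross_of_links`). Any other
component can lose a vertex, and repeating this leaves only cross-polytopes.

A non-sparse graph contains a rare subgraph. Grow a dense component from one clique, each new vertex
being joined to d pairwise adjacent old ones, and stop once m vertices carry more than dm edges.
Before that the total excess over d edges per vertex is bounded. Hence all but boundedly many x have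
their back-neighbours inside {y} ∪ B y for some back-neighbour y. On m given vertices this leaves at
most poly(m) (m 2^((d+1)^2))^m configurations with dm+1 edges (`card_isBackSystem_le`). As n p^d ≤
c^d, their expected number is at most p Σ poly(m) (e 2^((d+1)^2) c^d)^m. The ratio is below 1, so
this is O(p) and tends to 0. -/

namespace RandomFlag

/-! ### Collapses of set families, links and stars. -/

section

variable {α : Type*}

/-- One elementary collapse of a family of finite sets, removing sets of at least `k` elements. -/
def PairRemoval (k : ℕ) (F F' : Set (Finset α)) : Prop :=
  ∃ σ τ, k ≤ σ.card ∧ σ ∈ F ∧ τ ∈ F ∧ σ ⊂ τ ∧ (∀ ρ ∈ F, σ ⊂ ρ → ρ = τ) ∧ F' = F \ {σ, τ}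

/-- A finite sequence of elementary collapses, removing sets of at least `k` elements. -/
def FamilyCollapse (k : ℕ) : Set (Finset α) → Set (Finset α) → Prop :=
  Relation.ReflTransGen (PairRemoval k)

theorem FamilyCollapse.subset {k : ℕ} {F F' : Set (Finset α)} (h : FamilyCollapse k F F') :
    F' ⊆ F := by
  induction h with
  | refl => exact subset_rfl
  | tail _ h ih =>
    obtain ⟨σ, τ, -, -, -, -, -, rfl⟩ := h
    exact Set.sdiff_subset.trans ih

theorem FamilyCollapse.mono {k l : ℕ} (hkl : k ≤ l) {F F' : Set (Finset α)}
    (h : FamilyCollapse l F F') : FamilyCollapse k F F' := by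
  refine Relation.ReflTransGen.mono (fun F F' hF => ?_) F F' h
  obtain ⟨σ, τ, h, h'⟩ := hF
  exact ⟨σ, τ, hkl.trans h, h'⟩

/-- A collapse of an upward closed part of a family is a collapse of the family. -/
theorem FamilyCollapse.of_upper_part {k : ℕ} {F E E' : Set (Finset α)} (hEF : E ⊆ F)
    (hup : ∀ s ∈ E, ∀ t ∈ F, s ⊂ t → t ∈ E) (h : FamilyCollapse k E E') :
    FamilyCollapse k F (F \ E ∪ E') := by
  induction h with
  | refl =>
    rw [Set.sdiff_union_of_subset hEF]
    exact Relation.ReflTransGen.refl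
  | @tail E₁ E₂ hE h ih =>
    refine ih.tail ?_
    have hsub := FamilyCollapse.subset hE
    obtain ⟨σ, τ, h1, h2, h3, h4, h5, rfl⟩ := h
    refine ⟨σ, τ, h1, Or.inr h2, Or.inr h3, h4, ?_, ?_⟩
    -- No set outside `E` contains `σ`, because `E` is upward closed; so `σ` stays free in the whole
    -- family.
    · rintro ρ (hρ | hρ) hlt
      · exact absurd (hup σ (hsub h2) ρ hρ.1 hlt) hρ.2
      · exact h5 ρ hρ hlt
    · ext s
      have := hsub h2
      have := hsub h3
      simp only [Set.mem_union, Set.mem_sdiff, Set.mem_insert_iff, Set.mem_singleton_iff]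
      grind

/-- The cliques with at least `k + 1` vertices all of whose `(k + 1)`-subsets lie in `𝒯`. -/
def flagSpan (G : SimpleGraph α) (k : ℕ) (𝒯 : Finset (Finset α)) : Set (Finset α) :=
  {s | k + 1 ≤ s.card ∧ G.IsClique (s : Set α) ∧ ∀ t ⊆ s, t.card = k + 1 → t ∈ 𝒯}

/-- A family of `(k + 1)`-cliques that contains all the `(k + 1)`-subsets of a `(k + 2)`-clique as
soon as it contains two of them. -/
structure IsFlagFamily (G : SimpleGraph α) (k : ℕ) (𝒯 : Finset (Finset α)) : Prop where
  card_eq : ∀ t ∈ 𝒯, t.card = k + 1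
  isClique : ∀ t ∈ 𝒯, G.IsClique (t : Set α)
  fill : ∀ s : Finset α, s.card = k + 2 → G.IsClique (s : Set α) → ∀ t ∈ 𝒯, ∀ t' ∈ 𝒯,
    t ⊆ s → t' ⊆ s → t ≠ t' → ∀ u ⊆ s, u.card = k + 1 → u ∈ 𝒯

/-- The members of `F` with more than `k` vertices are those spanned by `𝒯`, and `F` contains the
`k`-subsets of the members of `𝒯`. -/
structure Carries (G : SimpleGraph α) (k : ℕ) (𝒯 : Finset (Finset α)) (F : Set (Finset α)) :
    Prop where
  large : ∀ s : Finset α, k + 1 ≤ s.card → (s ∈ F ↔ s ∈ flagSpan G k 𝒯)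
  small : ∀ t ∈ 𝒯, ∀ s ⊆ t, s.card = k → s ∈ F

/-- Every family carrying `𝒯` collapses to a family of sets with at most `k` elements. -/
def IsCollapsible (G : SimpleGraph α) (k : ℕ) (𝒯 : Finset (Finset α)) : Prop :=
  ∀ F, Carries G k 𝒯 F → ∃ F', FamilyCollapse k F F' ∧ ∀ s ∈ F', s.card ≤ k

theorem isCollapsible_empty (G : SimpleGraph α) (k : ℕ) : IsCollapsible G k ∅ := by
  intro F hF
  refine ⟨F, Relation.ReflTransGen.refl, fun s hs => ?_⟩
  by_contra! hk
  obtain ⟨-, -, h⟩ := (hF.large s hk).1 hs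
  obtain ⟨t, ht, htc⟩ := Finset.exists_subset_card_eq (show k + 1 ≤ s.card from hk)
  simpa using h t ht htc

end

variable {α : Type*} [DecidableEq α]

/-- The sets `s` avoiding `v` for which `insert v s` lies in `F`. -/
def familyLink (v : α) (F : Set (Finset α)) : Set (Finset α) := {s | v ∉ s ∧ insert v s ∈ F}

/-- A collapse of the link of `v` induces a collapse of the star of `v`. -/
theorem FamilyCollapse.of_link (v : α) {k : ℕ} {F L : Set (Finset α)}
    (h : FamilyCollapse k (familyLink v F) L) :
    FamilyCollapse (k + 1) F {s ∈ F | v ∈ s → s.erase v ∈ L} := by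
  induction h with
  | refl =>
    have : {s ∈ F | v ∈ s → s.erase v ∈ familyLink v F} = F := by
      ext s
      simp +contextual [familyLink, Finset.insert_erase]
    rw [this]
    exact Relation.ReflTransGen.refl
  | @tail L L' hL h ih =>
    refine ih.tail ?_
    have hsub := FamilyCollapse.subset hL
    obtain ⟨σ, τ, h1, h2, h3, h4, h5, rfl⟩ := h
    obtain ⟨hσ, hσF⟩ := hsub h2
    obtain ⟨hτ, hτF⟩ := hsub h3
    refine ⟨insert v σ, insert v τ, ?_, ⟨hσF, ?_⟩, ⟨hτF, ?_⟩, ?_, ?_, ?_⟩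
    · rw [Finset.card_insert_of_notMem hσ]; omega
    · intro _; rwa [Finset.erase_insert hσ]
    · intro _; rwa [Finset.erase_insert hτ]
    · refine ⟨Finset.insert_subset_insert _ h4.1, fun h => h4.2 ?_⟩
      intro x hx
      have := h (Finset.mem_insert_of_mem hx)
      grind
    · rintro ρ ⟨hρF, hρ⟩ hlt
      have hv : v ∈ ρ := hlt.1 (Finset.mem_insert_self _ _)
      rw [← h5 _ (hρ hv) ?_, Finset.insert_erase hv]
      refine ⟨?_, fun h => hlt.2 ?_⟩
      · intro x hx
        have := hlt.1 (Finset.mem_insert_of_mem hx)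
        grind
      · intro x hx
        have := @h x
        grind
    · ext s
      simp only [Set.mem_ofPred_eq, Set.mem_sdiff, Set.mem_insert_iff, Set.mem_singleton_iff]
      constructor
      · rintro ⟨hF, h⟩
        refine ⟨⟨hF, fun hv => (h hv).1⟩, ?_⟩
        rintro (rfl | rfl)
        · exact (h (Finset.mem_insert_self _ _)).2 (Or.inl (Finset.erase_insert hσ))
        · exact (h (Finset.mem_insert_self _ _)).2 (Or.inr (Finset.erase_insert hτ))
      · rintro ⟨⟨hF, h⟩, hne⟩
        refine ⟨hF, fun hv => ⟨h hv, ?_⟩⟩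
        rintro (rfl | rfl)
        · exact hne (Or.inl (Finset.insert_erase hv).symm)
        · exact hne (Or.inr (Finset.insert_erase hv).symm)

/-- The family of all subsets of a nonempty set collapses to the empty family. -/
theorem FamilyCollapse.powerset {V : Finset α} (hV : V.Nonempty) :
    FamilyCollapse 0 {s | s ⊆ V} ∅ := by
  induction hV using Finset.Nonempty.cons_induction with
  | singleton v =>
    -- The empty set acts as a free face. Families may contain it, and in a link it stands for the
    -- vertex that was removed.
    refine Relation.ReflTransGen.single ⟨∅, {v}, by simp, by simp, by simp, by simp, ?_, ?_⟩
    · intro ρ hρ hlt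
      rcases Finset.subset_singleton_iff.1 hρ with rfl | rfl
      · exact absurd hlt (ssubset_irrefl _)
      · rfl
    · ext s
      simp [Finset.subset_singleton_iff]
      tauto
  | cons w V hw hV ih =>
    have hlink : familyLink w {s | s ⊆ Finset.cons w V hw} = {s | s ⊆ V} := by
      ext s
      simp only [familyLink, Set.mem_ofPred_eq]
      constructor
      · rintro ⟨h1, h2⟩ x hx
        have := h2 (Finset.mem_insert_of_mem hx)
        grind
      · intro h
        refine ⟨fun hw' => hw (h hw'), ?_⟩
        intro x hx
        have := @h x
        grind
    rw [← hlink] at ih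
    -- The smaller simplex is collapsed twice: as the link of `w`, to remove the star, and as what
    -- then remains.
    have h1 := (FamilyCollapse.of_link w ih).mono (Nat.zero_le 1)
    have h2 : {s ∈ {s | s ⊆ Finset.cons w V hw} | w ∈ s → s.erase w ∈ (∅ : Set (Finset α))}
        = {s | s ⊆ V} := by
      ext s
      simp only [Set.mem_ofPred_eq, Set.mem_empty_iff_false, imp_false]
      constructor
      · rintro ⟨h1, h2⟩ x hx
        have := h1 hx
        grind
      · intro h
        refine ⟨h.trans (by simp), fun hw' => hw (h hw')⟩
    rw [h2] at h1
    rw [hlink] at ih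
    exact h1.trans ih

/-- The link of a vertex in a family of finite sets. -/
def link (v : α) (𝒯 : Finset (Finset α)) : Finset (Finset α) :=
  (𝒯.filter (v ∈ ·)).image (·.erase v)

theorem mem_link {v : α} {𝒯 : Finset (Finset α)} {t : Finset α} :
    t ∈ link v 𝒯 ↔ v ∉ t ∧ insert v t ∈ 𝒯 := by
  simp only [link, Finset.mem_image, Finset.mem_filter]
  constructor
  · rintro ⟨s, ⟨h1, h2⟩, rfl⟩
    exact ⟨Finset.notMem_erase _ _, by rwa [Finset.insert_erase h2]⟩
  · rintro ⟨h1, h2⟩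
    exact ⟨insert v t, ⟨h2, Finset.mem_insert_self _ _⟩, Finset.erase_insert h1⟩

/-- Two distinct `(k + 1)`-subsets cover a `(k + 2)`-set. Since `v` is adjacent to both, adding it
gives a clique, and filling applies one dimension higher. -/
theorem IsFlagFamily.link {G : SimpleGraph α} {k : ℕ} {𝒯 : Finset (Finset α)}
    (h : IsFlagFamily G (k + 1) 𝒯) (v : α) : IsFlagFamily G k (link v 𝒯) where
  card_eq t ht := by
    rw [mem_link] at ht
    have := h.card_eq _ ht.2
    rw [Finset.card_insert_of_notMem ht.1] at this
    omega
  isClique t ht := by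
    rw [mem_link] at ht
    exact (h.isClique _ ht.2).subset (by simp)
  fill s hs hc t ht t' ht' hts hts' hne u hu huc := by
    rw [mem_link] at ht ht' ⊢
    have ht1 := h.card_eq _ ht.2
    rw [Finset.card_insert_of_notMem ht.1] at ht1
    have ht1' := h.card_eq _ ht'.2
    rw [Finset.card_insert_of_notMem ht'.1] at ht1'
    have hun : s = t ∪ t' := by
      symm
      refine Finset.eq_of_subset_of_card_le (Finset.union_subset hts hts') ?_
      have : t ⊂ t ∪ t' := by
        refine ⟨Finset.subset_union_left, fun h => hne ?_⟩
        refine (Finset.eq_of_subset_of_card_le (Finset.subset_union_right.trans h) (by omega)).symm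
      have := Finset.card_lt_card this
      omega
    have hvs : v ∉ s := by
      rw [hun]; simp [ht.1, ht'.1]
    have hcl : G.IsClique (insert v s : Finset α) := by
      have h1 := h.isClique _ ht.2
      have h2 := h.isClique _ ht'.2
      rw [Finset.coe_insert, SimpleGraph.isClique_insert] at h1 h2 ⊢
      refine ⟨hc, fun b hb hvb => ?_⟩
      rw [hun] at hb
      rcases Finset.mem_union.1 hb with hb | hb
      · exact h1.2 b hb hvb
      · exact h2.2 b hb hvb
    refine ⟨fun hv => hvs (hu hv), ?_⟩
    refine h.fill (insert v s) ?_ hcl _ ht.2 _ ht'.2 (Finset.insert_subset_insert _ hts)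
      (Finset.insert_subset_insert _ hts') ?_ _ (Finset.insert_subset_insert _ hu) ?_
    · rw [Finset.card_insert_of_notMem hvs]; omega
    · intro he
      apply hne
      rw [← Finset.erase_insert ht.1, he, Finset.erase_insert ht'.1]
    · rw [Finset.card_insert_of_notMem (fun hv => hvs (hu hv))]; omega

/-- In a `(k + 2)`-clique through `v` only one `(k + 1)`-subset avoids `v`, so filling is never
triggered there. -/
theorem IsFlagFamily.filter_notMem {G : SimpleGraph α} {k : ℕ} {𝒯 : Finset (Finset α)}
    (h : IsFlagFamily G k 𝒯) (v : α) : IsFlagFamily G k (𝒯.filter (v ∉ ·)) where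
  card_eq t ht := h.card_eq t (Finset.mem_filter.1 ht).1
  isClique t ht := h.isClique t (Finset.mem_filter.1 ht).1
  fill s hs hc t ht t' ht' hts hts' hne u hu huc := by
    rw [Finset.mem_filter] at ht ht' ⊢
    refine ⟨h.fill s hs hc t ht.1 t' ht'.1 hts hts' hne u hu huc, fun hvu => ?_⟩
    have h1 := h.card_eq t ht.1
    have h2 := h.card_eq t' ht'.1
    have e1 : t = s.erase v := Finset.eq_of_subset_of_card_le
      (fun x hx => Finset.mem_erase.2 ⟨fun e => ht.2 (e ▸ hx), hts hx⟩)
      (by rw [Finset.card_erase_of_mem (hu hvu)]; omega)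
    have e2 : t' = s.erase v := Finset.eq_of_subset_of_card_le
      (fun x hx => Finset.mem_erase.2 ⟨fun e => ht'.2 (e ▸ hx), hts' hx⟩)
      (by rw [Finset.card_erase_of_mem (hu hvu)]; omega)
    exact hne (e1.trans e2.symm)

theorem Carries.link {G : SimpleGraph α} {k : ℕ} {𝒯 : Finset (Finset α)} {F : Set (Finset α)}
    (h𝒯 : IsFlagFamily G (k + 1) 𝒯) (h : Carries G (k + 1) 𝒯 F) (v : α) :
    Carries G k (link v 𝒯) (familyLink v F) where
  small t ht s hs hk := by
    rw [mem_link] at ht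
    have hv : v ∉ s := fun hv => ht.1 (hs hv)
    exact ⟨hv, h.small _ ht.2 _ (Finset.insert_subset_insert _ hs)
      (by rw [Finset.card_insert_of_notMem hv, hk])⟩
  large s hs := by
    constructor
    · rintro ⟨hv, hF⟩
      rw [h.large _ (by rw [Finset.card_insert_of_notMem hv]; omega)] at hF
      refine ⟨hs, hF.2.1.subset (by simp), fun t ht htc => mem_link.2 ?_⟩
      have hvt : v ∉ t := fun hv' => hv (ht hv')
      exact ⟨hvt, hF.2.2 _ (Finset.insert_subset_insert _ ht)
        (by rw [Finset.card_insert_of_notMem hvt, htc])⟩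
    · rintro ⟨-, hc, hall⟩
      have key : ∀ r ⊆ s, r.card ≤ k + 1 → ∃ t ⊆ s, r ⊆ t ∧ t.card = k + 1 ∧ v ∉ t ∧
          insert v t ∈ 𝒯 := by
        intro r hr hrc
        obtain ⟨t, h1, h2, h3⟩ := Finset.exists_subsuperset_card_eq hr hrc hs
        have := mem_link.1 (hall t h2 h3)
        exact ⟨t, h2, h1, h3, this.1, this.2⟩
      have key1 : ∀ x ∈ s, x ≠ v ∧ G.Adj v x := by
        intro x hx
        obtain ⟨t, -, h1, -, h2, h3⟩ := key {x} (by simpa using hx) (by simp)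
        have hxt : x ∈ t := h1 (by simp)
        have hne : x ≠ v := by rintro rfl; exact h2 hxt
        exact ⟨hne, h𝒯.isClique _ h3 (by simp) (by simp [hxt]) hne.symm⟩
      have hv : v ∉ s := fun hv => (key1 v hv).1 rfl
      have hcl : G.IsClique (insert v s : Finset α) := by
        rw [Finset.coe_insert, SimpleGraph.isClique_insert]
        exact ⟨hc, fun b hb _ => (key1 b hb).2⟩
      refine ⟨hv, (h.large _ (by rw [Finset.card_insert_of_notMem hv]; omega)).2 ⟨?_, hcl, ?_⟩⟩
      · rw [Finset.card_insert_of_notMem hv]; omega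
      · intro t ht htc
        by_cases hvt : v ∈ t
        · have h1 : t.erase v ⊆ s := fun x hx => by
            have := ht (Finset.mem_of_mem_erase hx)
            grind
          have := (mem_link.1 (hall _ h1 (by rw [Finset.card_erase_of_mem hvt]; omega))).2
          rwa [Finset.insert_erase hvt] at this
        -- The link says nothing directly about a set `t` avoiding `v`. It does put the other facets
        -- of `insert v t` into `𝒯`, and two of these suffice for filling.
        · have hts : t ⊆ s := fun x hx => by
            have := ht hx
            grind
          have hex : ∀ x ∈ t, insert v (t.erase x) ∈ 𝒯 := fun x hx => by
            refine (mem_link.1 (hall _ ((Finset.erase_subset _ _).trans hts) ?_)).2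
            rw [Finset.card_erase_of_mem hx]; omega
          obtain ⟨x, hx, y, hy, hxy⟩ := Finset.one_lt_card.1 (show 1 < t.card by omega)
          refine h𝒯.fill (insert v t) (by rw [Finset.card_insert_of_notMem hvt]; omega)
            (hcl.subset (by exact_mod_cast Finset.insert_subset_insert _ hts)) _ (hex x hx)
            _ (hex y hy) (Finset.insert_subset_insert _ (Finset.erase_subset _ _))
            (Finset.insert_subset_insert _ (Finset.erase_subset _ _)) ?_ t (by simp) htc
          intro he
          have : x ∈ insert v (t.erase y) := by grind
          rw [← he] at this
          grind

/-- If the link of `v` is collapsible then the star of `v` can be removed. -/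
theorem Carries.exists_collapse_star {G : SimpleGraph α} {k : ℕ} {𝒯 : Finset (Finset α)}
    {F : Set (Finset α)} (h𝒯 : IsFlagFamily G (k + 1) 𝒯) (h : Carries G (k + 1) 𝒯 F) (v : α)
    (hv : IsCollapsible G k (RandomFlag.link v 𝒯)) :
    ∃ F', FamilyCollapse (k + 1) F F' ∧ Carries G (k + 1) (𝒯.filter (v ∉ ·)) F' := by
  obtain ⟨L, hL, hLk⟩ := hv _ (h.link h𝒯 v)
  refine ⟨_, FamilyCollapse.of_link v hL, ?_, ?_⟩
  · intro s hs
    constructor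
    · rintro ⟨hF, hvs⟩
      rw [h.large s hs] at hF
      have hnv : v ∉ s := fun hv => by
        have := hLk _ (hvs hv)
        rw [Finset.card_erase_of_mem hv] at this
        omega
      exact ⟨hs, hF.2.1, fun t ht htc => Finset.mem_filter.2
        ⟨hF.2.2 t ht htc, fun hv => hnv (ht hv)⟩⟩
    · rintro ⟨-, hc, hall⟩
      refine ⟨(h.large s hs).2 ⟨hs, hc, fun t ht htc => (Finset.mem_filter.1 (hall t ht htc)).1⟩,
        fun hvs => ?_⟩
      obtain ⟨t, h1, h2, h3⟩ := Finset.exists_subsuperset_card_eq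
        (show {v} ⊆ s by simpa using hvs) (show _ ≤ k + 1 + 1 by simp) hs
      exact absurd (h1 (Finset.mem_singleton_self v)) (Finset.mem_filter.1 (hall t h2 h3)).2
  · intro t ht s hs hsk
    rw [Finset.mem_filter] at ht
    exact ⟨h.small t ht.1 s hs hsk, fun hv => absurd (hs hv) ht.2⟩

theorem IsCollapsible.of_link {G : SimpleGraph α} {k : ℕ} {𝒯 : Finset (Finset α)}
    (h𝒯 : IsFlagFamily G (k + 1) 𝒯) (v : α) (hv : IsCollapsible G k (RandomFlag.link v 𝒯))
    (h : IsCollapsible G (k + 1) (𝒯.filter (v ∉ ·))) : IsCollapsible G (k + 1) 𝒯 := by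
  intro F hF
  obtain ⟨F₁, h1, h2⟩ := hF.exists_collapse_star h𝒯 v hv
  obtain ⟨F₂, h3, h4⟩ := h F₁ h2
  exact ⟨F₂, h1.trans h3, h4⟩

/-- The vertices of a family of finite sets. -/
def vertices (𝒯 : Finset (Finset α)) : Finset α := 𝒯.biUnion id

theorem mem_vertices {𝒯 : Finset (Finset α)} {v : α} : v ∈ vertices 𝒯 ↔ ∃ t ∈ 𝒯, v ∈ t := by
  simp [vertices]

theorem vertices_filter_subset (𝒯 : Finset (Finset α)) (v : α) :
    vertices (𝒯.filter (v ∉ ·)) ⊆ (vertices 𝒯).erase v := by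
  intro x hx
  obtain ⟨t, ht, hxt⟩ := mem_vertices.1 hx
  rw [Finset.mem_filter] at ht
  exact Finset.mem_erase.2 ⟨fun e => ht.2 (e ▸ hxt), mem_vertices.2 ⟨t, ht.1, hxt⟩⟩

theorem card_filter_notMem_lt {𝒯 : Finset (Finset α)} {v : α} (hv : v ∈ vertices 𝒯) :
    (𝒯.filter (v ∉ ·)).card < 𝒯.card := by
  obtain ⟨t, ht, hvt⟩ := mem_vertices.1 hv
  exact Finset.card_lt_card (Finset.filter_ssubset.2 ⟨t, ht, by simpa using hvt⟩)

theorem vertices_link_subset (𝒯 : Finset (Finset α)) (v : α) :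
    vertices (link v 𝒯) ⊆ (vertices 𝒯).erase v := by
  intro x hx
  obtain ⟨t, ht, hxt⟩ := mem_vertices.1 hx
  rw [mem_link] at ht
  exact Finset.mem_erase.2 ⟨fun e => ht.1 (e ▸ hxt),
    mem_vertices.2 ⟨_, ht.2, Finset.mem_insert_of_mem hxt⟩⟩

theorem adj_of_mem_vertices_link {G : SimpleGraph α} {k : ℕ} {𝒯 : Finset (Finset α)}
    (h : IsFlagFamily G k 𝒯) {v x : α} (hx : x ∈ vertices (link v 𝒯)) : G.Adj v x := by
  obtain ⟨t, ht, hxt⟩ := mem_vertices.1 hx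
  rw [mem_link] at ht
  exact h.isClique _ ht.2 (by simp) (by simp [hxt]) (by rintro rfl; exact ht.1 hxt)

/-- For nonempty `𝒯` the family is a full simplex, its empty face being supplied by `Carries.small`.
-/
theorem isCollapsible_zero_of_isClique {G : SimpleGraph α} {𝒯 : Finset (Finset α)}
    (h : IsFlagFamily G 0 𝒯) (hc : G.IsClique (vertices 𝒯 : Set α)) : IsCollapsible G 0 𝒯 := by
  rcases 𝒯.eq_empty_or_nonempty with rfl | ⟨t₀, ht₀⟩
  · exact isCollapsible_empty G 0
  intro F hF
  have hsing : ∀ x, {x} ∈ 𝒯 ↔ x ∈ vertices 𝒯 := by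
    intro x
    rw [mem_vertices]
    constructor
    · exact fun h => ⟨_, h, by simp⟩
    · rintro ⟨t, ht, hx⟩
      obtain ⟨y, rfl⟩ := Finset.card_eq_one.1 (h.card_eq t ht)
      rw [Finset.mem_singleton] at hx
      rwa [hx]
  have hF' : F = {s | s ⊆ vertices 𝒯} := by
    ext s
    rcases s.eq_empty_or_nonempty with rfl | hs
    · simpa using hF.small t₀ ht₀ ∅ (by simp) rfl
    rw [hF.large s (Finset.card_pos.2 hs)]
    constructor
    · rintro ⟨-, -, h⟩ x hx
      exact (hsing x).1 (h {x} (by simpa using hx) rfl)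
    · intro hsub
      refine ⟨Finset.card_pos.2 hs, hc.subset (by exact_mod_cast hsub), fun t ht htc => ?_⟩
      obtain ⟨y, rfl⟩ := Finset.card_eq_one.1 htc
      exact (hsing y).2 (hsub (by simpa using ht))
  have hne : (vertices 𝒯).Nonempty := by
    obtain ⟨y, rfl⟩ := Finset.card_eq_one.1 (h.card_eq t₀ ht₀)
    exact ⟨y, (hsing y).1 ht₀⟩
  refine ⟨∅, ?_, by simp⟩
  rw [hF']
  exact FamilyCollapse.powerset hne

/-- Pairwise adjacency passes to links and deletions, so vertices can be deleted one by one, each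
link collapsing by induction on `k`. -/
theorem isCollapsible_of_isClique {G : SimpleGraph α} {k : ℕ} {𝒯 : Finset (Finset α)}
    (h : IsFlagFamily G k 𝒯) (hc : G.IsClique (vertices 𝒯 : Set α)) : IsCollapsible G k 𝒯 := by
  induction k generalizing 𝒯 with
  | zero => exact isCollapsible_zero_of_isClique h hc
  | succ k ih =>
    induction hn : 𝒯.card using Nat.strong_induction_on generalizing 𝒯 with
    | _ n ih' =>
    rcases (vertices 𝒯).eq_empty_or_nonempty with he | ⟨v, hv⟩
    · have : 𝒯 = ∅ := by
        refine Finset.eq_empty_of_forall_notMem fun t ht => ?_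
        obtain ⟨x, hx⟩ := Finset.card_pos.1 (show 0 < t.card by rw [h.card_eq t ht]; omega)
        have := mem_vertices.2 ⟨t, ht, hx⟩
        simp [he] at this
      rw [this]
      exact isCollapsible_empty G _
    · refine IsCollapsible.of_link h v (ih (h.link v) ?_) (ih' _ (hn ▸ card_filter_notMem_lt hv)
        (h.filter_notMem v) ?_ rfl)
      · exact hc.subset (by exact_mod_cast (vertices_link_subset 𝒯 v).trans (Finset.erase_subset _ _))
      · exact hc.subset
          (by exact_mod_cast (vertices_filter_subset 𝒯 v).trans (Finset.erase_subset _ _))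

end RandomFlag

/-! ### Cross-polytopes and flag families with few vertices. -/

namespace RandomFlag

theorem exists_not_adj_of_not_isClique {α : Type*} {G : SimpleGraph α} {V : Finset α}
    (h : ¬ G.IsClique (V : Set α)) : ∃ v ∈ V, ∃ v' ∈ V, v ≠ v' ∧ ¬ G.Adj v v' := by
  by_contra! hcon
  exact h fun x hx y hy hxy => hcon x hx y hy hxy

variable {α : Type*} [DecidableEq α]

/-- `𝒯` is the family of facets of a cross-polytope boundary with vertices `f i a`, which is the
clique complex of the subgraph of `G` induced on these vertices. -/
structure IsCrossLabelling (G : SimpleGraph α) (k : ℕ) (𝒯 : Finset (Finset α))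
    (f : Fin (k + 1) → Fin 2 → α) : Prop where
  inj : ∀ i a j b, f i a = f j b → i = j ∧ a = b
  adj : ∀ i a j b, G.Adj (f i a) (f j b) ↔ i ≠ j
  mem : ∀ s : Finset α, s ∈ 𝒯 ↔
    s.card = k + 1 ∧ G.IsClique (s : Set α) ∧ ∀ x ∈ s, ∃ i a, f i a = x

/-- `𝒯` is the family of facets of an induced cross-polytope boundary. -/
def IsCross (G : SimpleGraph α) (k : ℕ) (𝒯 : Finset (Finset α)) : Prop :=
  ∃ f, IsCrossLabelling G k 𝒯 f

namespace IsCrossLabelling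

variable {G : SimpleGraph α} {k : ℕ} {𝒯 : Finset (Finset α)} {f : Fin (k + 1) → Fin 2 → α}

theorem image_mem (h : IsCrossLabelling G k 𝒯 f) (a : Fin (k + 1) → Fin 2) :
    Finset.univ.image (fun i => f i (a i)) ∈ 𝒯 := by
  refine (h.mem _).2 ⟨?_, ?_, ?_⟩
  · rw [Finset.card_image_of_injective _ (fun i j hij => (h.inj _ _ _ _ hij).1)]
    simp
  · rintro x hx y hy hxy
    simp only [Finset.coe_image, Finset.coe_univ, Set.image_univ, Set.mem_range] at hx hy
    obtain ⟨i, rfl⟩ := hx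
    obtain ⟨j, rfl⟩ := hy
    exact (h.adj _ _ _ _).2 (by rintro rfl; exact hxy rfl)
  · intro x hx
    obtain ⟨i, -, rfl⟩ := Finset.mem_image.1 hx
    exact ⟨_, _, rfl⟩

theorem mem_vertices_iff (h : IsCrossLabelling G k 𝒯 f) {x : α} :
    x ∈ vertices 𝒯 ↔ ∃ i a, f i a = x := by
  rw [mem_vertices]
  constructor
  · rintro ⟨t, ht, hx⟩
    exact ((h.mem t).1 ht).2.2 x hx
  · rintro ⟨i, a, rfl⟩
    exact ⟨_, h.image_mem (fun _ => a), Finset.mem_image.2 ⟨i, Finset.mem_univ _, rfl⟩⟩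

theorem card_vertices (h : IsCrossLabelling G k 𝒯 f) : (vertices 𝒯).card = 2 * k + 2 := by
  have : vertices 𝒯 = Finset.univ.image (fun p : Fin (k + 1) × Fin 2 => f p.1 p.2) := by
    ext x
    simp [h.mem_vertices_iff]
  rw [this, Finset.card_image_of_injective]
  · simp; ring
  · rintro ⟨i, a⟩ ⟨j, b⟩ hij
    have := h.inj _ _ _ _ hij
    simpa using this

/-- A clique meets each antipodal pair at most once. -/
theorem card_le (h : IsCrossLabelling G k 𝒯 f) {s : Finset α} (hs : G.IsClique (s : Set α))
    (hsub : ∀ x ∈ s, ∃ i a, f i a = x) : s.card ≤ k + 1 := by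
  choose! i a hia using hsub
  have : s.card ≤ (Finset.univ : Finset (Fin (k + 1))).card := by
    refine Finset.card_le_card_of_injOn i (fun _ _ => Finset.mem_coe.2 (Finset.mem_univ _)) ?_
    intro x hx y hy hxy
    by_contra hne
    have := hs hx hy hne
    rw [← hia x hx, ← hia y hy, h.adj] at this
    exact this hxy
  simpa using this

end IsCrossLabelling

namespace IsCross

variable {G : SimpleGraph α} {k : ℕ} {𝒯 : Finset (Finset α)}

theorem card_vertices (h : IsCross G k 𝒯) : (vertices 𝒯).card = 2 * k + 2 :=
  h.choose_spec.card_vertices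

theorem mem_iff (h : IsCross G k 𝒯) (s : Finset α) :
    s ∈ 𝒯 ↔ s.card = k + 1 ∧ G.IsClique (s : Set α) ∧ s ⊆ vertices 𝒯 := by
  obtain ⟨f, hf⟩ := h
  rw [hf.mem]
  simp only [← hf.mem_vertices_iff]
  rfl

theorem card_le (h : IsCross G k 𝒯) {s : Finset α} (hs : G.IsClique (s : Set α))
    (hsub : s ⊆ vertices 𝒯) : s.card ≤ k + 1 := by
  obtain ⟨f, hf⟩ := h
  exact hf.card_le hs fun x hx => hf.mem_vertices_iff.1 (hsub hx)

theorem exists_antipode (h : IsCross G k 𝒯) {u : α} (hu : u ∈ vertices 𝒯) :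
    ∃ u' ∈ vertices 𝒯, u' ≠ u ∧ ¬ G.Adj u u' ∧
      ∀ w ∈ vertices 𝒯, w ≠ u → w ≠ u' → G.Adj u w := by
  obtain ⟨f, hf⟩ := h
  simp only [hf.mem_vertices_iff] at hu ⊢
  obtain ⟨i, a, rfl⟩ := hu
  refine ⟨f i (1 - a), ⟨i, _, rfl⟩, ?_, ?_, ?_⟩
  · intro he
    have hne : ∀ a : Fin 2, 1 - a ≠ a := by decide
    exact hne a (hf.inj _ _ _ _ he).2
  · simp [hf.adj]
  · rintro w ⟨j, b, rfl⟩ h1 h2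
    rw [hf.adj]
    rintro rfl
    have : b = a ∨ b = 1 - a := by
      clear h1 h2
      revert a b; decide
    rcases this with rfl | rfl
    · exact h1 rfl
    · exact h2 rfl

/-- Two cross-polytope boundaries induced on the same vertices agree. -/
theorem eq_of_vertices_eq {𝒯' : Finset (Finset α)} (h : IsCross G k 𝒯) (h' : IsCross G k 𝒯')
    (hV : vertices 𝒯 = vertices 𝒯') : 𝒯 = 𝒯' := by
  ext s
  rw [h.mem_iff, h'.mem_iff, hV]

theorem of_not_adj (h𝒯 : IsFlagFamily G 0 𝒯) {v v' : α} (hne : v ≠ v') (hadj : ¬ G.Adj v v')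
    (hV : vertices 𝒯 = {v, v'}) : IsCross G 0 𝒯 := by
  have hmem : ∀ x, x ∈ vertices 𝒯 ↔ {x} ∈ 𝒯 := by
    intro x
    rw [mem_vertices]
    constructor
    · rintro ⟨t, ht, hx⟩
      obtain ⟨y, rfl⟩ := Finset.card_eq_one.1 (h𝒯.card_eq t ht)
      rw [Finset.mem_singleton] at hx
      rwa [hx]
    · exact fun h => ⟨_, h, by simp⟩
  refine ⟨fun _ => ![v, v'], ?_, ?_, ?_⟩
  · intro i a j b
    fin_cases i; fin_cases j; fin_cases a <;> fin_cases b <;> simp [hne, hne.symm]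
  · intro i a j b
    have hadj' : ¬ G.Adj v' v := fun h => hadj h.symm
    fin_cases i; fin_cases j; fin_cases a <;> fin_cases b <;> simp [hadj, hadj']
  · intro s
    constructor
    · intro hs
      refine ⟨h𝒯.card_eq s hs, h𝒯.isClique s hs, fun x hx => ?_⟩
      have : x ∈ vertices 𝒯 := mem_vertices.2 ⟨s, hs, hx⟩
      rw [hV, Finset.mem_insert, Finset.mem_singleton] at this
      rcases this with rfl | rfl
      · exact ⟨0, 0, rfl⟩
      · exact ⟨0, 1, rfl⟩
    · rintro ⟨hs, -, hs'⟩
      obtain ⟨y, rfl⟩ := Finset.card_eq_one.1 hs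
      rw [← hmem, hV]
      obtain ⟨i, a, h⟩ := hs' y (by simp)
      fin_cases a
      · simpa using Or.inl h.symm
      · simpa using Or.inr h.symm

/-- A family with two nonadjacent vertices sharing the same cross-polytope as link, and without
further vertices, is the suspension of that cross-polytope. -/
theorem of_link (h𝒯 : IsFlagFamily G (k + 1) 𝒯) {v v' : α} (hne : v ≠ v') (hadj : ¬ G.Adj v v')
    (hv : IsCross G k (link v 𝒯)) (hlink : link v' 𝒯 = link v 𝒯)
    (hV : vertices 𝒯 ⊆ insert v (insert v' (vertices (link v 𝒯)))) : IsCross G (k + 1) 𝒯 := by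
  obtain ⟨f, hf⟩ := id hv
  have hfv : ∀ i a, G.Adj v (f i a) := fun i a =>
    adj_of_mem_vertices_link h𝒯 (hf.mem_vertices_iff.2 ⟨i, a, rfl⟩)
  have hfv' : ∀ i a, G.Adj v' (f i a) := fun i a =>
    adj_of_mem_vertices_link h𝒯 (hlink ▸ hf.mem_vertices_iff.2 ⟨i, a, rfl⟩)
  have hadj' : ¬ G.Adj v' v := fun h => hadj h.symm
  refine ⟨Fin.cons ![v, v'] f, ?_, ?_, ?_⟩
  · intro i a j b
    refine Fin.cases ?_ (fun i => ?_) i <;> refine Fin.cases ?_ (fun j => ?_) j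
    · fin_cases a <;> fin_cases b <;> simp [hne, hne.symm]
    · fin_cases a
      · simp [(hfv j b).ne]
      · simp [(hfv' j b).ne]
    · fin_cases b
      · simp [(hfv i a).ne']
      · simp [(hfv' i a).ne']
    · intro h
      have := hf.inj _ _ _ _ h
      simpa using this
  · intro i a j b
    refine Fin.cases ?_ (fun i => ?_) i <;> refine Fin.cases ?_ (fun j => ?_) j
    · fin_cases a <;> fin_cases b <;> simp [hadj, hadj']
    · fin_cases a
      · simp [hfv j b, (Fin.succ_ne_zero j).symm]
      · simp [hfv' j b, (Fin.succ_ne_zero j).symm]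
    · fin_cases b
      · simp [(hfv i a).symm]
      · simp [(hfv' i a).symm]
    · simp [hf.adj]
  · intro s
    have hrange : ∀ x, (∃ i a, (Fin.cons ![v, v'] f : Fin (k + 1 + 1) → Fin 2 → α) i a = x) ↔
        x = v ∨ x = v' ∨ ∃ i a, f i a = x := by
      intro x
      rw [Fin.exists_fin_succ]
      simp [Fin.exists_fin_two, eq_comm, or_assoc]
    simp only [hrange]
    constructor
    · intro hs
      refine ⟨h𝒯.card_eq s hs, h𝒯.isClique s hs, fun x hx => ?_⟩
      have := hV (mem_vertices.2 ⟨s, hs, hx⟩)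
      rwa [Finset.mem_insert, Finset.mem_insert, hf.mem_vertices_iff] at this
    · rintro ⟨hs, hc, hall⟩
      by_cases h1 : v ∈ s
      · have : s.erase v ∈ link v 𝒯 := by
          refine (hf.mem _).2 ⟨by rw [Finset.card_erase_of_mem h1]; omega, hc.subset (by simp), ?_⟩
          intro x hx
          have hxs := Finset.mem_of_mem_erase hx
          have hxv := Finset.ne_of_mem_erase hx
          rcases hall x hxs with rfl | rfl | h
          · exact absurd rfl hxv
          · exact absurd (hc h1 hxs hne) hadj
          · exact h
        have := (mem_link.1 this).2
        rwa [Finset.insert_erase h1] at this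
      by_cases h2 : v' ∈ s
      · have : s.erase v' ∈ link v' 𝒯 := by
          rw [hlink]
          refine (hf.mem _).2 ⟨by rw [Finset.card_erase_of_mem h2]; omega, hc.subset (by simp), ?_⟩
          intro x hx
          have hxs := Finset.mem_of_mem_erase hx
          have hxv := Finset.ne_of_mem_erase hx
          rcases hall x hxs with rfl | rfl | h
          · exact absurd hxs h1
          · exact absurd rfl hxv
          · exact h
        have := (mem_link.1 this).2
        rwa [Finset.insert_erase h2] at this
      · have := hf.card_le hc fun x hx => by
          rcases hall x hx with rfl | rfl | h
          · exact absurd hx h1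
          · exact absurd hx h2
          · exact h
        omega

end IsCross

/-- A flag family with at most `2k + 2` vertices is collapsible, unless it is the cross-polytope. -/
theorem isCollapsible_or_isCross {G : SimpleGraph α} {k : ℕ} {𝒯 : Finset (Finset α)}
    (h : IsFlagFamily G k 𝒯) (hV : (vertices 𝒯).card ≤ 2 * k + 2) :
    IsCollapsible G k 𝒯 ∨ IsCross G k 𝒯 := by
  induction k generalizing 𝒯 with
  | zero =>
    by_cases hc : G.IsClique (vertices 𝒯 : Set α)
    · exact Or.inl (isCollapsible_zero_of_isClique h hc)
    obtain ⟨v, hv, v', hv', hne, hadj⟩ := exists_not_adj_of_not_isClique hc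
    refine Or.inr (IsCross.of_not_adj h hne hadj ?_)
    refine (Finset.eq_of_subset_of_card_le ?_ ?_).symm
    · simp [Finset.insert_subset_iff, hv, hv']
    · rw [Finset.card_pair hne]; exact hV
  | succ k ih =>
    induction hn : 𝒯.card using Nat.strong_induction_on generalizing 𝒯 with
    | _ n ih' =>
    by_cases hlink : ∃ v ∈ vertices 𝒯, IsCollapsible G k (link v 𝒯)
    · obtain ⟨v, hv, hvc⟩ := hlink
      refine Or.inl (IsCollapsible.of_link h v hvc ?_)
      have hcard := Finset.card_le_card (vertices_filter_subset 𝒯 v)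
      rw [Finset.card_erase_of_mem hv] at hcard
      rcases ih' _ (hn ▸ card_filter_notMem_lt hv) (h.filter_notMem v) (by omega) rfl with h' | h'
      · exact h'
      -- The deletion cost a vertex, so too few remain for a cross-polytope.
      · have := h'.card_vertices
        omega
    push Not at hlink
    by_cases hc : G.IsClique (vertices 𝒯 : Set α)
    · exact Or.inl (isCollapsible_of_isClique h hc)
    obtain ⟨v, hv, v', hv', hne, hadj⟩ := exists_not_adj_of_not_isClique hc
    -- A non-neighbour `v'` leaves at most `2 * k + 2` vertices for the link of `v`. As that link is
    -- not collapsible, it is a cross-polytope and uses all of them.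
    have key : ∀ v ∈ vertices 𝒯, ∀ v' ∈ vertices 𝒯, v ≠ v' → ¬ G.Adj v v' →
        IsCross G k (link v 𝒯) ∧ vertices (link v 𝒯) = ((vertices 𝒯).erase v).erase v' := by
      intro v hv v' hv' hne hadj
      have hsub : vertices (link v 𝒯) ⊆ ((vertices 𝒯).erase v).erase v' := fun x hx =>
        Finset.mem_erase.2 ⟨fun e => hadj (e ▸ adj_of_mem_vertices_link h hx),
          vertices_link_subset 𝒯 v hx⟩
      have hcard : (((vertices 𝒯).erase v).erase v').card ≤ 2 * k + 2 := by
        rw [Finset.card_erase_of_mem (Finset.mem_erase.2 ⟨hne.symm, hv'⟩),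
          Finset.card_erase_of_mem hv]
        omega
      have hcross := (ih (h.link v) ((Finset.card_le_card hsub).trans hcard)).resolve_left
        (hlink v hv)
      exact ⟨hcross, Finset.eq_of_subset_of_card_le hsub (by rw [hcross.card_vertices]; exact hcard)⟩
    obtain ⟨h1, h2⟩ := key v hv v' hv' hne hadj
    obtain ⟨h3, h4⟩ := key v' hv' v hv hne.symm (fun h => hadj h.symm)
    -- The two links are cross-polytopes on the same vertices, hence equal, and `𝒯` is their
    -- suspension.
    refine Or.inr (IsCross.of_link h hne hadj h1 ?_ ?_)
    · refine h3.eq_of_vertices_eq h1 ?_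
      rw [h2, h4, Finset.erase_right_comm]
    · rw [h2]
      intro x hx
      simp only [Finset.mem_insert, Finset.mem_erase]
      tauto

end RandomFlag

/-! ### Strong components and the effect of sparsity. -/

namespace RandomFlag

open Classical in
/-- The neighbours of `x` in `V`. -/
noncomputable def nbrsIn {α : Type*} (G : SimpleGraph α) (V : Finset α) (x : α) : Finset α :=
  V.filter (G.Adj x)

theorem mem_nbrsIn {α : Type*} {G : SimpleGraph α} {V : Finset α} {x y : α} :
    y ∈ nbrsIn G V x ↔ y ∈ V ∧ G.Adj x y := by
  simp [nbrsIn]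

variable {α : Type*} [DecidableEq α]

/-- Any two members of `S` are joined by a sequence of members in which consecutive ones meet in
`k` vertices. -/
def StronglyConnected (k : ℕ) (S : Finset (Finset α)) : Prop :=
  ∀ s ∈ S, ∀ t ∈ S, Relation.ReflTransGen (fun a b => b ∈ S ∧ (a ∩ b).card = k) s t

/-- `S` is a union of strongly connected components of `𝒯`. -/
structure IsClosedIn (k : ℕ) (S 𝒯 : Finset (Finset α)) : Prop where
  subset : S ⊆ 𝒯
  mem : ∀ t ∈ S, ∀ t' ∈ 𝒯, (t ∩ t').card = k → t' ∈ S

open Classical in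
/-- The strongly connected component of `s` in `𝒯`. -/
noncomputable def component (k : ℕ) (𝒯 : Finset (Finset α)) (s : Finset α) :
    Finset (Finset α) :=
  𝒯.filter (Relation.ReflTransGen (fun a b => b ∈ 𝒯 ∧ (a ∩ b).card = k) s)

theorem mem_component {k : ℕ} {𝒯 : Finset (Finset α)} {s t : Finset α} :
    t ∈ component k 𝒯 s ↔
      t ∈ 𝒯 ∧ Relation.ReflTransGen (fun a b => b ∈ 𝒯 ∧ (a ∩ b).card = k) s t := by
  simp [component]

theorem mem_component_self {k : ℕ} {𝒯 : Finset (Finset α)} {s : Finset α} (hs : s ∈ 𝒯) :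
    s ∈ component k 𝒯 s :=
  mem_component.2 ⟨hs, Relation.ReflTransGen.refl⟩

theorem isClosedIn_component (k : ℕ) (𝒯 : Finset (Finset α)) (s : Finset α) :
    IsClosedIn k (component k 𝒯 s) 𝒯 where
  subset _ ht := (mem_component.1 ht).1
  mem _ ht _ ht' htt' := mem_component.2 ⟨ht', (mem_component.1 ht).2.tail ⟨ht', htt'⟩⟩

/-- Paths from `s` stay in the component and can be reversed, so any two members are joined through
`s`. -/
theorem stronglyConnected_component (k : ℕ) (𝒯 : Finset (Finset α)) {s : Finset α} (hs : s ∈ 𝒯) :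
    StronglyConnected k (component k 𝒯 s) := by
  have h1 : ∀ t, Relation.ReflTransGen (fun a b => b ∈ 𝒯 ∧ (a ∩ b).card = k) s t →
      t ∈ component k 𝒯 s ∧
      Relation.ReflTransGen (fun a b => b ∈ component k 𝒯 s ∧ (a ∩ b).card = k) s t ∧
      Relation.ReflTransGen (fun a b => b ∈ component k 𝒯 s ∧ (a ∩ b).card = k) t s := by
    intro t h
    induction h with
    | refl => exact ⟨mem_component_self hs, .refl, .refl⟩
    | tail h' h ih =>
      have hc := mem_component.2 ⟨h.1, h'.tail h⟩
      refine ⟨hc, ih.2.1.tail ⟨hc, h.2⟩, .head ⟨ih.1, ?_⟩ ih.2.2⟩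
      rw [Finset.inter_comm]
      exact h.2
  intro t ht t' ht'
  exact (h1 t (mem_component.1 ht).2).2.2.trans (h1 t' (mem_component.1 ht').2).2.1

theorem component_eq_of_mem {k : ℕ} {𝒯 : Finset (Finset α)} {s t : Finset α} (hs : s ∈ 𝒯)
    (ht : t ∈ component k 𝒯 s) : component k 𝒯 t = component k 𝒯 s := by
  have hsub : component k 𝒯 s ⊆ 𝒯 := (isClosedIn_component k 𝒯 s).subset
  have hts : Relation.ReflTransGen (fun a b => b ∈ 𝒯 ∧ (a ∩ b).card = k) t s :=
    Relation.ReflTransGen.mono (fun _ _ h => ⟨hsub h.1, h.2⟩) _ _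
      (stronglyConnected_component k 𝒯 hs t ht s (mem_component_self hs))
  ext u
  rw [mem_component, mem_component]
  exact and_congr_right fun _ => ⟨(mem_component.1 ht).2.trans, hts.trans⟩

namespace IsClosedIn

variable {G : SimpleGraph α} {k : ℕ} {S 𝒯 : Finset (Finset α)}

/-- If all the `(k + 1)`-subsets of a set lie in `𝒯` and one of them lies in `S` then all do. -/
theorem mem_of_subset (h : IsClosedIn k S 𝒯) {s t u : Finset α}
    (hs : ∀ t ⊆ s, t.card = k + 1 → t ∈ 𝒯) (ht : t ∈ S) (hts : t ⊆ s) (htc : t.card = k + 1)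
    (hus : u ⊆ s) (huc : u.card = k + 1) : u ∈ S := by
  -- Vertices of `t` are exchanged one at a time for vertices of `u`; each exchange keeps `k` common
  -- vertices.
  induction hn : (u \ t).card generalizing t with
  | zero =>
    have : u ⊆ t := by simpa using hn
    rwa [Finset.eq_of_subset_of_card_le this (by omega)]
  | succ n ih =>
    obtain ⟨x, hx⟩ := Finset.card_pos.1 (show 0 < (u \ t).card by omega)
    have h2 : (t \ u).card = (u \ t).card := Finset.card_sdiff_comm (by omega)
    obtain ⟨y, hy⟩ := Finset.card_pos.1 (show 0 < (t \ u).card by omega)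
    rw [Finset.mem_sdiff] at hx hy
    have hx' : x ∉ t.erase y := fun h => hx.2 (Finset.mem_of_mem_erase h)
    have hc : (insert x (t.erase y)).card = k + 1 := by
      rw [Finset.card_insert_of_notMem hx', Finset.card_erase_of_mem hy.1]; omega
    have hsub : insert x (t.erase y) ⊆ s :=
      Finset.insert_subset (hus hx.1) ((Finset.erase_subset _ _).trans hts)
    refine ih (h.mem t ht _ (hs _ hsub hc) ?_) hsub hc ?_
    · have : t ∩ insert x (t.erase y) = t.erase y := by
        ext z; grind
      rw [this, Finset.card_erase_of_mem hy.1]; omega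
    · have : u \ insert x (t.erase y) = (u \ t).erase x := by
        ext z; grind
      rw [this, Finset.card_erase_of_mem (Finset.mem_sdiff.2 hx)]; omega

theorem isFlagFamily (h : IsClosedIn k S 𝒯) (h𝒯 : IsFlagFamily G k 𝒯) : IsFlagFamily G k S where
  card_eq t ht := h𝒯.card_eq t (h.subset ht)
  isClique t ht := h𝒯.isClique t (h.subset ht)
  fill s hs hc t ht t' ht' hts hts' hne _ :=
    h.mem_of_subset (h𝒯.fill s hs hc t (h.subset ht) t' (h.subset ht') hts hts' hne) ht hts
      (h𝒯.card_eq t (h.subset ht))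

theorem flagSpan_subset (h : IsClosedIn k S 𝒯) : flagSpan G k S ⊆ flagSpan G k 𝒯 :=
  fun _ hs => ⟨hs.1, hs.2.1, fun t ht htc => h.subset (hs.2.2 t ht htc)⟩

theorem mem_flagSpan_of_subset (h : IsClosedIn k S 𝒯) {s t : Finset α}
    (hs : s ∈ flagSpan G k 𝒯) (ht : t ∈ S) (hts : t ⊆ s) (htc : t.card = k + 1) :
    s ∈ flagSpan G k S :=
  ⟨hs.1, hs.2.1, fun _ => h.mem_of_subset hs.2.2 ht hts htc⟩

/-- If the link of `v` in the closed part `S` of `𝒯` is collapsible then the members of `S` that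
contain `v` can be removed. -/
theorem exists_collapse_star (h : IsClosedIn (k + 1) S 𝒯) (h𝒯 : IsFlagFamily G (k + 1) 𝒯)
    {F : Set (Finset α)} (hF : Carries G (k + 1) 𝒯 F) {v : α}
    (hv : IsCollapsible G k (link v S)) :
    ∃ F', FamilyCollapse (k + 1) F F' ∧ Carries G (k + 1) (𝒯 \ S ∪ S.filter (v ∉ ·)) F' := by
  -- The part of the family belonging to the component: its ridges, which are needed as free faces,
  -- and everything it spans.
  set E : Set (Finset α) :=
    {s | (s.card = k + 1 ∧ ∃ t ∈ S, s ⊆ t) ∨ s ∈ flagSpan G (k + 1) S} with hE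
  have hEF : E ⊆ F := by
    rintro s (⟨hs, t, ht, hst⟩ | hs)
    · exact hF.small t (h.subset ht) s hst hs
    · exact (hF.large s hs.1).2 (h.flagSpan_subset hs)
  -- A set strictly above a ridge of `S` contains a facet through that ridge. This facet lies in `S`
  -- by closedness, so `S` spans the whole set.
  have hup : ∀ s ∈ E, ∀ t ∈ F, s ⊂ t → t ∈ E := by
    rintro s hs t ht hst
    have hlt := Finset.card_lt_card hst
    have hts : k + 1 + 1 ≤ t.card := by
      rcases hs with hs | hs
      · omega
      · have := hs.1
        omega
    have htspan := (hF.large t hts).1 ht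
    rcases hs with ⟨hs, r, hr, hsr⟩ | hs
    · obtain ⟨u, h1, h2, h3⟩ := Finset.exists_subsuperset_card_eq hst.1
        (show s.card ≤ k + 1 + 1 by omega) hts
      have hu𝒯 := htspan.2.2 u h2 h3
      refine Or.inr (h.mem_flagSpan_of_subset htspan (t := u) ?_ h2 h3)
      have hrc := h𝒯.card_eq r (h.subset hr)
      by_cases hru : r = u
      · exact hru ▸ hr
      · refine h.mem r hr u hu𝒯 (le_antisymm ?_ ?_)
        · have : (r ∩ u).card < r.card := by
            refine Finset.card_lt_card ⟨Finset.inter_subset_left, fun h => hru ?_⟩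
            exact Finset.eq_of_subset_of_card_le (h.trans Finset.inter_subset_right) (by omega)
          omega
        · rw [← hs]
          exact Finset.card_le_card (Finset.subset_inter hsr h1)
    · obtain ⟨u, h1, h2⟩ := Finset.exists_subset_card_eq hs.1
      exact Or.inr (h.mem_flagSpan_of_subset htspan (hs.2.2 u h1 h2) (h1.trans hst.1) h2)
  have hcar : Carries G (k + 1) S E := by
    refine ⟨fun s hs => ⟨?_, Or.inr⟩, fun t ht s hst hs => Or.inl ⟨hs, t, ht, hst⟩⟩
    rintro (⟨h1, -⟩ | h1)
    · omega
    · exact h1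
  obtain ⟨E', hE', hcar'⟩ := hcar.exists_collapse_star (h.isFlagFamily h𝒯) v hv
  refine ⟨_, FamilyCollapse.of_upper_part hEF hup hE', ?_, ?_⟩
  · intro s hs
    rw [Set.mem_union, Set.mem_sdiff, hF.large s hs, hcar.large s hs, hcar'.large s hs]
    constructor
    · rintro (⟨h1, h2⟩ | h1)
      · refine ⟨hs, h1.2.1, fun t ht htc => Finset.mem_union_left _ (Finset.mem_sdiff.2
          ⟨h1.2.2 t ht htc, fun htS => h2 (h.mem_flagSpan_of_subset h1 htS ht htc)⟩)⟩
      · exact ⟨hs, h1.2.1, fun t ht htc => Finset.mem_union_right _ (h1.2.2 t ht htc)⟩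
    · intro h1
      have h2 : s ∈ flagSpan G (k + 1) 𝒯 := by
        refine ⟨hs, h1.2.1, fun t ht htc => ?_⟩
        rcases Finset.mem_union.1 (h1.2.2 t ht htc) with h3 | h3
        · exact (Finset.mem_sdiff.1 h3).1
        · exact h.subset (Finset.mem_filter.1 h3).1
      by_cases h3 : s ∈ flagSpan G (k + 1) S
      · refine Or.inr ⟨hs, h1.2.1, fun t ht htc => ?_⟩
        rcases Finset.mem_union.1 (h1.2.2 t ht htc) with h4 | h4
        · exact absurd (h3.2.2 t ht htc) (Finset.mem_sdiff.1 h4).2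
        · exact h4
      · exact Or.inl ⟨h2, h3⟩
  · intro t ht s hst hs
    rcases Finset.mem_union.1 ht with h1 | h1
    · rw [Finset.mem_sdiff] at h1
      refine Or.inl ⟨hF.small t h1.1 s hst hs, ?_⟩
      -- A ridge shared with `S` would put `t` into `S`, so the ridges of other components are
      -- untouched.
      rintro (⟨-, r, hr, hsr⟩ | h2)
      · refine h1.2 (h.mem r hr t h1.1 (le_antisymm ?_ ?_))
        · have hrc := h𝒯.card_eq r (h.subset hr)
          have htc := h𝒯.card_eq t h1.1
          have : (r ∩ t).card < r.card := by
            refine Finset.card_lt_card ⟨Finset.inter_subset_left, fun h3 => h1.2 ?_⟩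
            rwa [← Finset.eq_of_subset_of_card_le (h3.trans Finset.inter_subset_right)
              (by omega)]
          omega
        · rw [← hs]
          exact Finset.card_le_card (Finset.subset_inter hsr hst)
      · have := h2.1
        omega
    · exact Or.inr (hcar'.small t h1 s hst hs)

/-- The sets produced by one filling in `𝒯` lie all inside `S` or all outside it; inside, this is a
vertex deletion. -/
theorem isFlagFamily_sdiff_union (h : IsClosedIn k S 𝒯) (h𝒯 : IsFlagFamily G k 𝒯) (v : α) :
    IsFlagFamily G k (𝒯 \ S ∪ S.filter (v ∉ ·)) := by
  have hsub : 𝒯 \ S ∪ S.filter (v ∉ ·) ⊆ 𝒯 := by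
    refine Finset.union_subset Finset.sdiff_subset ((Finset.filter_subset _ _).trans h.subset)
  have hfil : ∀ t ∈ 𝒯 \ S ∪ S.filter (v ∉ ·), t ∈ S → t ∈ S.filter (v ∉ ·) := by
    intro t ht htS
    rcases Finset.mem_union.1 ht with h1 | h1
    · exact absurd htS (Finset.mem_sdiff.1 h1).2
    · exact h1
  refine ⟨fun t ht => h𝒯.card_eq t (hsub ht), fun t ht => h𝒯.isClique t (hsub ht), ?_⟩
  intro s hs hc t ht t' ht' hts hts' hne u hu huc
  have hall := h𝒯.fill s hs hc t (hsub ht) t' (hsub ht') hts hts' hne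
  have htc := h𝒯.card_eq t (hsub ht)
  have htc' := h𝒯.card_eq t' (hsub ht')
  by_cases htS : t ∈ S
  · have htS' := h.mem_of_subset hall htS hts htc hts' htc'
    exact Finset.mem_union_right _ (((h.isFlagFamily h𝒯).filter_notMem v).fill s hs hc t
      (hfil t ht htS) t' (hfil t' ht' htS') hts hts' hne u hu huc)
  · exact Finset.mem_union_left _ (Finset.mem_sdiff.2
      ⟨hall u hu huc, fun huS => htS (h.mem_of_subset hall huS hu huc hts htc)⟩)

end IsClosedIn

theorem vertices_link_subset_nbrsIn {G : SimpleGraph α} {k : ℕ} {S : Finset (Finset α)}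
    (hS : IsFlagFamily G k S) (v : α) : vertices (link v S) ⊆ nbrsIn G (vertices S) v :=
  fun _ hx => mem_nbrsIn.2 ⟨Finset.mem_of_mem_erase (vertices_link_subset S v hx),
    adj_of_mem_vertices_link hS hx⟩

/-- A strongly connected flag family all of whose links are cross-polytopes spanning the whole
neighbourhood is a cross-polytope. -/
theorem isCross_of_links {G : SimpleGraph α} {k : ℕ} (hk : 1 ≤ k) {S : Finset (Finset α)}
    (hS : IsFlagFamily G (k + 1) S) (hne : S.Nonempty) (hconn : StronglyConnected (k + 1) S)
    (hcross : ∀ v ∈ vertices S, IsCross G k (link v S))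
    (hnbr : ∀ v ∈ vertices S, vertices (link v S) = nbrsIn G (vertices S) v) :
    IsCross G (k + 1) S := by
  set V := vertices S with hV
  set N := nbrsIn G V with hN
  have hcard : ∀ v ∈ V, (N v).card = 2 * k + 2 := fun v hv => by
    rw [← hnbr v hv, (hcross v hv).card_vertices]
  have hsymm : ∀ {x y}, x ∈ V → y ∈ N x → x ∈ N y := fun hx hy =>
    mem_nbrsIn.2 ⟨hx, (mem_nbrsIn.1 hy).2.symm⟩
  have hNV : ∀ {x y}, y ∈ N x → y ∈ V := fun hy => (mem_nbrsIn.1 hy).1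
  have anti : ∀ v ∈ V, ∀ u ∈ N v, ∃ u' ∈ N v, u' ≠ u ∧ ¬ G.Adj u u' ∧
      ∀ w ∈ N v, w ≠ u → w ≠ u' → G.Adj u w := by
    intro v hv u hu
    have := (hcross v hv).exists_antipode (u := u) (by rwa [hnbr v hv])
    rwa [hnbr v hv] at this
  obtain ⟨s₀, hs₀⟩ := hne
  obtain ⟨v, hvs₀⟩ := Finset.card_pos.1 (show 0 < s₀.card by rw [hS.card_eq _ hs₀]; omega)
  have hv : v ∈ V := mem_vertices.2 ⟨s₀, hs₀, hvs₀⟩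
  obtain ⟨w, hw⟩ := Finset.card_pos.1 (show 0 < (N v).card by rw [hcard v hv]; omega)
  -- the antipode of `v` in the neighbourhood of `w`
  obtain ⟨v', hv'w, hv'ne, hv'adj, -⟩ := anti w (hNV hw) v (hsymm hv hw)
  have hv' : v' ∈ V := hNV hv'w
  -- any neighbour of both `v` and `v'` is adjacent to the common neighbours and nothing else
  have step1 : ∀ x ∈ N v, v' ∈ N x → ∀ y ∈ N x, y = v ∨ y = v' ∨ (y ∈ N v ∧ v' ∈ N y) := by
    intro x hx hv'x y hy
    obtain ⟨u, hu, hune, huadj, hall⟩ := anti x (hNV hx) v (hsymm hv hx)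
    have huv' : u = v' := by
      by_contra hne'
      exact hv'adj (hall v' hv'x hv'ne (Ne.symm hne'))
    subst huv'
    obtain ⟨u', hu', hune', huadj', hall'⟩ := anti x (hNV hx) u hv'x
    have hvu' : u' = v := by
      by_contra hne'
      exact hv'adj ((hall' v (hsymm hv hx) hv'ne.symm (Ne.symm hne')).symm)
    subst hvu'
    by_cases h1 : y = u'
    · exact Or.inl h1
    by_cases h2 : y = u
    · exact Or.inr (Or.inl h2)
    exact Or.inr (Or.inr ⟨mem_nbrsIn.2 ⟨hNV hy, hall y hy h1 h2⟩,
      mem_nbrsIn.2 ⟨hv', (hall' y hy h2 h1).symm⟩⟩)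
  have step2 : ∀ x ∈ N v, v' ∈ N x → ∀ y ∈ N v, G.Adj x y → v' ∈ N y := by
    intro x hx hv'x y hy hxy
    rcases step1 x hx hv'x y (mem_nbrsIn.2 ⟨hNV hy, hxy⟩) with rfl | rfl | h
    · exact absurd (mem_nbrsIn.1 hy).2 (G.loopless.irrefl _)
    · exact absurd (mem_nbrsIn.1 hy).2 hv'adj
    · exact h.2
  -- Adjacency to `v'` spreads from `w` along edges within `N v`. Only the antipode of `w` needs two
  -- steps.
  have step3 : ∀ y ∈ N v, v' ∈ N y := by
    intro y hy
    by_cases hwy : G.Adj w y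
    · exact step2 w hw hv'w y hy hwy
    by_cases hyw : y = w
    · rwa [hyw]
    obtain ⟨w', hw', hw'ne, hw'adj, hwall⟩ := anti v hv w hw
    have hyw' : y = w' := by
      by_contra h
      exact hwy (hwall y hy hyw h)
    -- Here `1 ≤ k` is essential: `N v` has at least four elements, so an intermediate vertex
    -- exists.
    obtain ⟨x, hx, hxw⟩ : ∃ x ∈ N v, x ∉ ({w, w'} : Finset α) := by
      by_contra! hcon
      have := Finset.card_le_card hcon
      rw [hcard v hv] at this
      have := Finset.card_le_two (a := w) (b := w')
      omega
    simp only [Finset.mem_insert, Finset.mem_singleton, not_or] at hxw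
    have hwx := hwall x hx hxw.1 hxw.2
    have hv'x := step2 w hw hv'w x hx hwx
    obtain ⟨y', hy', -, hyadj, hyall⟩ := anti v hv y hy
    refine step2 x hx hv'x y hy ?_
    have : y' = w := by
      by_contra h
      exact hwy (hyall w hw (Ne.symm hyw) (Ne.symm h)).symm
    exact (hyall x hx (hyw' ▸ hxw.2) (this ▸ hxw.1)).symm
  have hNN : N v = N v' := by
    refine Finset.eq_of_subset_of_card_le (fun y hy => ?_) (by rw [hcard v hv, hcard v' hv'])
    exact mem_nbrsIn.2 ⟨hNV hy, (mem_nbrsIn.1 (step3 y hy)).2.symm⟩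
  -- The right-hand side is closed under adjacency in `V`, so by strong connectivity it absorbs
  -- every member of `S`.
  have hVW : V ⊆ insert v (insert v' (N v)) := by
    have hcl : ∀ t ∈ S, ∀ x ∈ t, x ∈ insert v (insert v' (N v)) →
        t ⊆ insert v (insert v' (N v)) := by
      intro t ht x hx hxW y hy
      by_cases hxy : x = y
      · exact hxy ▸ hxW
      have hadj : G.Adj x y := hS.isClique t ht hx hy hxy
      have hyV : y ∈ V := mem_vertices.2 ⟨t, ht, hy⟩
      simp only [Finset.mem_insert] at hxW ⊢
      rcases hxW with rfl | rfl | hxN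
      · exact Or.inr (Or.inr (mem_nbrsIn.2 ⟨hyV, hadj⟩))
      · exact Or.inr (Or.inr (hNN ▸ mem_nbrsIn.2 ⟨hyV, hadj⟩))
      · rcases step1 x hxN (step3 x hxN) y (mem_nbrsIn.2 ⟨hyV, hadj⟩) with h | h | h
        · exact Or.inl h
        · exact Or.inr (Or.inl h)
        · exact Or.inr (Or.inr h.1)
    have hreach : ∀ t, Relation.ReflTransGen (fun a b => b ∈ S ∧ (a ∩ b).card = k + 1) s₀ t →
        t ⊆ insert v (insert v' (N v)) := by
      intro t h
      induction h with
      | refl => exact hcl s₀ hs₀ v hvs₀ (Finset.mem_insert_self _ _)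
      | tail _ h ih =>
        obtain ⟨x, hx⟩ := Finset.card_pos.1 (show 0 < _ by rw [h.2]; exact Nat.succ_pos k)
        rw [Finset.mem_inter] at hx
        exact hcl _ h.1 x hx.2 (ih hx.1)
    intro x hx
    obtain ⟨t, ht, hxt⟩ := mem_vertices.1 hx
    exact hreach t (hconn s₀ hs₀ t ht) hxt
  refine IsCross.of_link hS hv'ne.symm hv'adj (hcross v hv) ?_ (by rw [hnbr v hv]; exact hVW)
  refine (hcross v' hv').eq_of_vertices_eq (hcross v hv) ?_
  rw [hnbr v hv, hnbr v' hv']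
  exact hNN.symm

/-- A strongly connected flag family of average degree at most twice its dimension is a
cross-polytope or has a vertex whose link is collapsible. -/
theorem exists_isCollapsible_link_or_isCross {G : SimpleGraph α} {k : ℕ} (hk : 1 ≤ k)
    {S : Finset (Finset α)} (hS : IsFlagFamily G (k + 1) S) (hne : S.Nonempty)
    (hconn : StronglyConnected (k + 1) S)
    (hdeg : ∑ x ∈ vertices S, (nbrsIn G (vertices S) x).card ≤
      2 * (k + 1) * (vertices S).card) :
    (∃ v ∈ vertices S, IsCollapsible G k (link v S)) ∨ IsCross G (k + 1) S := by
  by_cases hlink : ∃ v ∈ vertices S, IsCollapsible G k (link v S)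
  · exact Or.inl hlink
  push Not at hlink
  -- With fewer vertices the link would be neither collapsible nor large enough to be a
  -- cross-polytope.
  have hge : ∀ v ∈ vertices S, 2 * k + 2 ≤ (vertices (link v S)).card := by
    intro v hv
    by_contra! h
    have := ((isCollapsible_or_isCross (hS.link v) h.le).resolve_left (hlink v hv)).card_vertices
    omega
  have hle : ∀ v, (vertices (link v S)).card ≤ (nbrsIn G (vertices S) v).card := fun v =>
    Finset.card_le_card (vertices_link_subset_nbrsIn hS v)
  -- Each degree is at least `2 * k + 2` and the average is at most that.
  have heq : ∀ v ∈ vertices S, (nbrsIn G (vertices S) v).card = 2 * k + 2 := by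
    have h1 : ∀ v ∈ vertices S, 2 * k + 2 ≤ (nbrsIn G (vertices S) v).card := fun v hv =>
      (hge v hv).trans (hle v)
    have h2 : ∑ v ∈ vertices S, (2 * k + 2) = ∑ v ∈ vertices S, (nbrsIn G (vertices S) v).card := by
      refine le_antisymm (Finset.sum_le_sum h1) (hdeg.trans (le_of_eq ?_))
      rw [Finset.sum_const, smul_eq_mul]
      ring
    exact fun v hv => (((Finset.sum_eq_sum_iff_of_le h1).1 h2) v hv).symm
  refine Or.inr (isCross_of_links hk hS hne hconn (fun v hv => ?_) (fun v hv => ?_))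
  · exact (isCollapsible_or_isCross (hS.link v) ((hle v).trans (heq v hv).le)).resolve_left
      (hlink v hv)
  · exact Finset.eq_of_subset_of_card_le (vertices_link_subset_nbrsIn hS v)
      ((heq v hv).le.trans (hge v hv))

/-- Every strongly connected set of `(d + 1)`-cliques of `G` induces a subgraph of average degree
at most `2d`. -/
def IsSparse (G : SimpleGraph α) (d : ℕ) : Prop :=
  ∀ S : Finset (Finset α), S.Nonempty → (∀ s ∈ S, s.card = d + 1 ∧ G.IsClique (s : Set α)) →
    StronglyConnected d S →
    ∑ x ∈ vertices S, (nbrsIn G (vertices S) x).card ≤ 2 * d * (vertices S).card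

/-- A component that is not a cross-polytope loses its members through some vertex while the others
are untouched; induct on the number of facets. -/
theorem IsSparse.exists_collapse {G : SimpleGraph α} {k : ℕ} (hk : 1 ≤ k)
    (hG : IsSparse G (k + 1)) {𝒯 : Finset (Finset α)} (h𝒯 : IsFlagFamily G (k + 1) 𝒯)
    {F : Set (Finset α)} (hF : Carries G (k + 1) 𝒯 F) :
    ∃ F' 𝒯', FamilyCollapse (k + 1) F F' ∧ Carries G (k + 1) 𝒯' F' ∧
      ∀ s ∈ 𝒯', IsCross G (k + 1) (component (k + 1) 𝒯' s) := by
  induction hn : 𝒯.card using Nat.strong_induction_on generalizing 𝒯 F with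
  | _ n ih =>
  by_cases hall : ∀ s ∈ 𝒯, IsCross G (k + 1) (component (k + 1) 𝒯 s)
  · exact ⟨F, 𝒯, Relation.ReflTransGen.refl, hF, hall⟩
  push Not at hall
  obtain ⟨s, hs, hscross⟩ := hall
  have hcl := isClosedIn_component (k + 1) 𝒯 s
  have hconn := stronglyConnected_component (k + 1) 𝒯 hs
  have hSflag := hcl.isFlagFamily h𝒯
  have hSne : (component (k + 1) 𝒯 s).Nonempty := ⟨s, mem_component_self hs⟩
  obtain ⟨v, hv, hvc⟩ := (exists_isCollapsible_link_or_isCross hk hSflag hSne hconn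
    (hG _ hSne (fun t ht => ⟨hSflag.card_eq t ht, hSflag.isClique t ht⟩) hconn)).resolve_right
    hscross
  obtain ⟨F₁, h1, h2⟩ := hcl.exists_collapse_star h𝒯 hF hvc
  have hlt : (𝒯 \ component (k + 1) 𝒯 s ∪ (component (k + 1) 𝒯 s).filter (v ∉ ·)).card < n := by
    rw [← hn]
    obtain ⟨t, ht, hvt⟩ := mem_vertices.1 hv
    refine Finset.card_lt_card ⟨Finset.union_subset Finset.sdiff_subset
      ((Finset.filter_subset _ _).trans hcl.subset), fun h => ?_⟩
    rcases Finset.mem_union.1 (h (hcl.subset ht)) with h5 | h5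
    · exact (Finset.mem_sdiff.1 h5).2 ht
    · exact (Finset.mem_filter.1 h5).2 hvt
  obtain ⟨F₂, 𝒯₂, h3, h4⟩ := ih _ hlt (hcl.isFlagFamily_sdiff_union h𝒯 v) h2 rfl
  exact ⟨F₂, 𝒯₂, h1.trans h3, h4⟩

end RandomFlag

/-! ### From set families back to simplicial complexes. -/

namespace RandomFlag

/-- Removing a free pair leaves a complex, because no remaining face can contain the free face. -/
theorem exists_collapsesTo {α : Type*} {k : ℕ} {K : PreAbstractSimplicialComplex α}
    {F : Set (Finset α)} (h : FamilyCollapse k K.faces F) : ∃ Y, CollapsesTo K Y ∧ Y.faces = F := by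
  induction h with
  | refl => exact ⟨K, Relation.ReflTransGen.refl, rfl⟩
  | tail _ h ih =>
    obtain ⟨Y, hY, rfl⟩ := ih
    obtain ⟨σ, τ, -, h1, h2, h3, h4, rfl⟩ := h
    refine ⟨⟨Y.faces \ {σ, τ}, ?_⟩, hY.tail ⟨σ, τ, ⟨h1, h2, h3, h4⟩, rfl⟩, rfl⟩
    rintro s ⟨hs, hne⟩
    refine ⟨(Y.isRelLowerSet_faces hs).1, fun t hts ht => ⟨(Y.isRelLowerSet_faces hs).2 hts ht, ?_⟩⟩
    have key : ¬ σ ⊆ s := fun hsub => by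
      by_cases he : s = σ
      · exact hne (Or.inl he)
      · exact hne (Or.inr (h4 s hs (hsub.ssubset_of_ne (Ne.symm he))))
    rintro (rfl | rfl)
    · exact key hts
    · exact key (h3.1.trans hts)

variable {α : Type*} [DecidableEq α]

theorem IsCrossLabelling.faces_map {G : SimpleGraph α} {d : ℕ} {𝒯 : Finset (Finset α)}
    {f : Fin (d + 1) → Fin 2 → α} (hf : IsCrossLabelling G d 𝒯 f) :
    ((crossPolytopeBoundary d).map fun p => f p.1 p.2).faces =
      {s | s.Nonempty ∧ ∃ t ∈ 𝒯, s ⊆ t} := by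
  classical
  ext s
  constructor
  · rintro ⟨q, ⟨hq, hqc⟩, rfl⟩
    refine ⟨hq.image _, ?_⟩
    -- Complete `q` to a facet: keep its vertex in each part it meets and take `0` in the others.
    let a : Fin (d + 1) → Fin 2 := fun i => if h : ∃ b, (⟨i, b⟩ : (_ : Fin (d + 1)) × Fin 2) ∈ q
      then h.choose else 0
    refine ⟨_, hf.image_mem a, ?_⟩
    intro x hx
    obtain ⟨⟨i, b⟩, hp, rfl⟩ := Finset.mem_image.1 hx
    have h : ∃ b, (⟨i, b⟩ : (_ : Fin (d + 1)) × Fin 2) ∈ q := ⟨b, hp⟩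
    have ha : a i = b := by
      simp only [a, dif_pos h]
      by_contra hne
      exact hqc h.choose_spec hp (fun he => hne (by simpa using he)) rfl
    exact Finset.mem_image.2 ⟨i, Finset.mem_univ _, by simp only [ha]⟩
  · rintro ⟨hs, t, ht, hst⟩
    obtain ⟨-, htc, hall⟩ := (hf.mem t).1 ht
    have himage : (Finset.univ.filter fun p : (_ : Fin (d + 1)) × Fin 2 => f p.1 p.2 ∈ s).image
        (fun p => f p.1 p.2) = s := by
      ext x
      simp only [Finset.mem_image, Finset.mem_filter, Finset.mem_univ, true_and]
      constructor
      · rintro ⟨p, hp, rfl⟩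
        exact hp
      · intro hx
        obtain ⟨i, b, rfl⟩ := hall x (hst hx)
        exact ⟨⟨i, b⟩, hx, rfl⟩
    refine ⟨_, ⟨?_, ?_⟩, himage⟩
    · rw [← himage] at hs
      exact Finset.image_nonempty.1 hs
    · rintro ⟨i, b⟩ hp ⟨j, c⟩ hq hne
      simp only [Finset.coe_filter, Finset.mem_univ, true_and, Set.mem_ofPred_eq] at hp hq
      have hne' : f i b ≠ f j c := fun he => by
        obtain ⟨rfl, rfl⟩ := hf.inj _ _ _ _ he
        exact hne rfl
      exact (hf.adj _ _ _ _).1 (htc (hst hp) (hst hq) hne')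

open Classical in
/-- The cliques of `G` with `d + 1` vertices. -/
noncomputable def cliques [Fintype α] (G : SimpleGraph α) (d : ℕ) : Finset (Finset α) :=
  Finset.univ.filter fun s => s.card = d + 1 ∧ G.IsClique (s : Set α)

theorem mem_cliques [Fintype α] {G : SimpleGraph α} {d : ℕ} {s : Finset α} :
    s ∈ cliques G d ↔ s.card = d + 1 ∧ G.IsClique (s : Set α) := by
  simp [cliques]

theorem isFlagFamily_cliques [Fintype α] (G : SimpleGraph α) (d : ℕ) :
    IsFlagFamily G d (cliques G d) where
  card_eq _ ht := (mem_cliques.1 ht).1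
  isClique _ ht := (mem_cliques.1 ht).2
  fill _ _ hc _ _ _ _ _ _ _ _ hu huc :=
    mem_cliques.2 ⟨huc, hc.subset (by exact_mod_cast hu)⟩

theorem carries_cliqueComplex [Fintype α] (G : SimpleGraph α) {d : ℕ} (hd : 1 ≤ d) :
    Carries G d (cliques G d) (cliqueComplex G).faces where
  large s hs := by
    constructor
    · rintro ⟨-, hc⟩
      exact ⟨hs, hc, fun t ht htc => mem_cliques.2 ⟨htc, hc.subset (by exact_mod_cast ht)⟩⟩
    · rintro ⟨-, hc, -⟩
      exact ⟨Finset.card_pos.1 (by omega), hc⟩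
  small t ht s hst hs :=
    ⟨Finset.card_pos.1 (by omega), (mem_cliques.1 ht).2.subset (by exact_mod_cast hst)⟩

/-- A complex whose `d`-dimensional faces form disjoint cross-polytopes in `G`. -/
theorem isFaceDisjointUnion_purePart {G : SimpleGraph α} {d : ℕ} {𝒯 : Finset (Finset α)}
    {Y : PreAbstractSimplicialComplex α}
    (hY : ∀ s : Finset α, s.card = d + 1 → (s ∈ Y.faces ↔ s ∈ 𝒯))
    (h𝒯 : ∀ s ∈ 𝒯, IsCross G d (component d 𝒯 s)) : IsFaceDisjointUnion d (purePart d Y) := by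
  have hcard : ∀ s ∈ 𝒯, s.card = d + 1 := fun s hs =>
    (((h𝒯 s hs).mem_iff s).1 (mem_component_self hs)).1
  refine ⟨{C | ∃ s ∈ 𝒯, C.faces = {r | r.Nonempty ∧ ∃ t ∈ component d 𝒯 s, r ⊆ t}}, ?_, ?_, ?_⟩
  · rintro C ⟨s, hs, hC⟩
    obtain ⟨f, hf⟩ := h𝒯 s hs
    refine ⟨fun p => f p.1 p.2, ?_, PreAbstractSimplicialComplex.ext (hC.trans hf.faces_map.symm)⟩
    rintro ⟨i, a⟩ ⟨j, b⟩ h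
    obtain ⟨rfl, rfl⟩ := hf.inj _ _ _ _ h
    rfl
  · rintro C ⟨s, hs, hC⟩ D ⟨s', hs', hD⟩ hne r hrC hrD hrc
    rw [hC] at hrC
    rw [hD] at hrD
    -- A shared `d`-dimensional face is a member of both components, which therefore coincide.
    have key : ∀ s, (∃ t ∈ component d 𝒯 s, r ⊆ t) → r ∈ component d 𝒯 s := by
      rintro s ⟨t, ht, hrt⟩
      have := hcard t (mem_component.1 ht).1
      rwa [Finset.eq_of_subset_of_card_le hrt (by omega)]
    have h1 := component_eq_of_mem hs (key s hrC.2)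
    have h2 := component_eq_of_mem hs' (key s' hrD.2)
    refine hne (PreAbstractSimplicialComplex.ext ?_)
    rw [hC, hD, ← h1, ← h2]
  · ext r
    simp only [Set.mem_iUnion]
    constructor
    · rintro ⟨hr, t, ht, htc, hrt⟩
      have ht' := (hY t htc).1 ht
      obtain ⟨f, hf⟩ := h𝒯 t ht'
      exact ⟨_, ⟨t, ht', hf.faces_map⟩,
        by rw [hf.faces_map]; exact ⟨hr, t, mem_component_self ht', hrt⟩⟩
    · rintro ⟨C, ⟨s, -, hC⟩, hrC⟩
      rw [hC] at hrC
      obtain ⟨hr, t, ht, hrt⟩ := hrC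
      have ht' := (mem_component.1 ht).1
      exact ⟨hr, t, (hY t (hcard t ht')).2 ht', hcard t ht', hrt⟩

/-- The clique complex of a sparse graph is almost `d`-collapsible. -/
theorem IsSparse.almostCollapsible [Fintype α] {G : SimpleGraph α} {d : ℕ} (hd : 2 ≤ d)
    (hG : IsSparse G d) : AlmostCollapsible d (cliqueComplex G) := by
  obtain ⟨k, rfl⟩ : ∃ k, d = k + 1 := ⟨d - 1, by omega⟩
  obtain ⟨F, 𝒯, h1, h2, h3⟩ := hG.exists_collapse (by omega) (isFlagFamily_cliques G (k + 1))
    (carries_cliqueComplex G (by omega))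
  obtain ⟨Y, hY, rfl⟩ := exists_collapsesTo h1
  refine ⟨Y, hY, fun s hs => ?_, isFaceDisjointUnion_purePart (G := G) (𝒯 := 𝒯) (fun s hs => ?_) h3⟩
  -- A face with more than `d + 1` vertices would be a clique within a single component, but cliques
  -- of a cross-polytope are smaller.
  · by_contra! hcard
    obtain ⟨-, hsc, hall⟩ := (h2.large s (by omega)).1 hs
    obtain ⟨t, hts, htc⟩ := Finset.exists_subset_card_eq (show k + 1 + 1 ≤ s.card by omega)
    have ht := hall t hts htc
    have hcross := h3 t ht
    have : s.card ≤ k + 1 + 1 := by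
      refine hcross.card_le hsc fun x hx => ?_
      obtain ⟨u, h4, h5, h6⟩ := Finset.exists_subsuperset_card_eq
        (show {x} ⊆ s by simpa using hx) (show _ ≤ k + 1 + 1 by simp) hcard.le
      exact mem_vertices.2 ⟨u, (isClosedIn_component _ 𝒯 t).mem_of_subset hall
        (mem_component_self ht) hts htc h5 h6, h4 (Finset.mem_singleton_self x)⟩
    omega
  · rw [h2.large s hs.ge]
    constructor
    · rintro ⟨-, -, h⟩
      exact h s subset_rfl hs
    · intro h
      refine ⟨hs.ge, (((h3 s h).mem_iff s).1 (mem_component_self h)).2.1, fun t hts htc => ?_⟩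
      rwa [Finset.eq_of_subset_of_card_le hts (by omega)]

end RandomFlag

/-! ### Growing a back system inside a non-sparse graph. -/

namespace RandomFlag

variable {α : Type*} [DecidableEq α]

/-- `B` is an acyclic orientation, each vertex `x` of `V` pointing to the members of `B x`, of a
graph on `V` with `d |V| + 1` edges, in which all but a bounded number of vertices `x` satisfy
`B x ⊆ {y} ∪ B y` for some `y ∈ B x`. -/
structure IsBackSystem (d : ℕ) (V : Finset α) (B : α → Finset α) : Prop where
  subset : ∀ x, B x ⊆ V
  eq_empty : ∀ x ∉ V, B x = ∅
  acyclic : ∃ r : α → ℕ, ∀ x, ∀ y ∈ B x, r y < r x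
  card_le : ∀ x, (B x).card ≤ (d + 1) ^ 2
  parent : ∃ Z ⊆ V, Z.card ≤ (d + 1) ^ 2 + 1 ∧
    ∀ x ∈ V, x ∉ Z → ∃ y ∈ B x, (B x).erase y ⊆ B y
  sum_card : ∑ x ∈ V, (B x).card = d * V.card + 1

/-- `B` is an acyclic orientation of the subgraph of `G` induced on `U ⊇ R` in which the vertices
outside `R` have out-degree at least `d`, and `B x ⊆ {y} ∪ B y` for some `y ∈ B x` where the
out-degree is `d`. -/
structure IsGrowth (G : SimpleGraph α) (d : ℕ) (R U : Finset α) (B : α → Finset α)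
    (r : α → ℕ) : Prop where
  root_subset : R ⊆ U
  subset : ∀ x, B x ⊆ U
  eq_empty : ∀ x ∉ U, B x = ∅
  rank_lt : ∀ x, ∀ y ∈ B x, r y < r x
  adj : ∀ x, ∀ y ∈ B x, G.Adj x y
  total : ∀ x ∈ U, ∀ y ∈ U, G.Adj x y → y ∈ B x ∨ x ∈ B y
  root_card : ∀ x ∈ R, (B x).card ≤ d
  le_card : ∀ x ∈ U, x ∉ R → d ≤ (B x).card
  parent : ∀ x ∈ U, x ∉ R → (B x).card = d → ∃ y ∈ B x, (B x).erase y ⊆ B y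

theorem exists_isGrowth_of_isClique [Fintype α] {G : SimpleGraph α} {d : ℕ} {R : Finset α}
    (hR : R.card = d + 1) (hc : G.IsClique (R : Set α)) : ∃ B r, IsGrowth G d R R B r := by
  let r : α → ℕ := fun x => Fintype.equivFin α x
  have hr : ∀ x y, r x = r y → x = y := fun x y h =>
    (Fintype.equivFin α).injective (Fin.ext h)
  have hmem : ∀ x y, y ∈ (if x ∈ R then R.filter (fun y => r y < r x) else ∅) ↔
      x ∈ R ∧ y ∈ R ∧ r y < r x := by
    intro x y
    split_ifs with h <;> simp [h]
  refine ⟨fun x => if x ∈ R then R.filter (fun y => r y < r x) else ∅, r, subset_rfl,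
    fun x y hy => ((hmem x y).1 hy).2.1, fun x hx => if_neg hx,
    fun x y hy => ((hmem x y).1 hy).2.2, fun x y hy => ?_, fun x hx y hy hxy => ?_, fun x hx => ?_,
    fun x hx hx' => absurd hx hx', fun x hx hx' => absurd hx hx'⟩
  · obtain ⟨h1, h2, h3⟩ := (hmem x y).1 hy
    exact hc h1 h2 (by rintro rfl; exact lt_irrefl _ h3)
  · rw [hmem, hmem]
    rcases lt_trichotomy (r x) (r y) with h | h | h
    · exact Or.inr ⟨hy, hx, h⟩
    · exact absurd (hr x y h) hxy.ne
    · exact Or.inl ⟨hx, hy, h⟩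
  · have : (if x ∈ R then R.filter (fun y => r y < r x) else ∅) ⊆ R.erase x := fun y hy => by
      obtain ⟨h1, h2, h3⟩ := (hmem x y).1 hy
      exact Finset.mem_erase.2 ⟨by rintro rfl; exact lt_irrefl _ h3, h2⟩
    refine (Finset.card_le_card this).trans ?_
    rw [Finset.card_erase_of_mem hx, hR]; omega

namespace IsGrowth

variable {G : SimpleGraph α} {d : ℕ} {R U : Finset α} {B : α → Finset α} {r : α → ℕ}

theorem rank_update_lt (h : IsGrowth G d R U B r) {x : α} (hx : x ∉ U) {P : Finset α}
    (hP : P ⊆ U) (z : α) : ∀ y ∈ Function.update B x P z,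
      Function.update r x (U.sup r + 1) y < Function.update r x (U.sup r + 1) z := by
  intro y hy
  have hyx : ∀ y ∈ U, Function.update r x (U.sup r + 1) y = r y := fun w hw =>
    Function.update_of_ne (fun e => hx (by rw [← e]; exact hw)) _ _
  by_cases hz : z = x
  · subst hz
    rw [Function.update_self] at hy
    rw [hyx y (hP hy), Function.update_self]
    exact Nat.lt_succ_of_le (Finset.le_sup (hP hy))
  · rw [Function.update_of_ne hz] at hy
    rw [hyx y (h.subset z hy), Function.update_of_ne hz]
    exact h.rank_lt z y hy

theorem update_subset (h : IsGrowth G d R U B r) (x : α) {P : Finset α}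
    (hP : P ⊆ U) (z : α) : Function.update B x P z ⊆ insert x U := by
  by_cases hz : z = x
  · subst hz
    rw [Function.update_self]
    exact hP.trans (Finset.subset_insert _ _)
  · rw [Function.update_of_ne hz]
    exact (h.subset z).trans (Finset.subset_insert _ _)

theorem update_eq_empty (h : IsGrowth G d R U B r) (x : α) {P : Finset α} (z : α)
    (hz : z ∉ insert x U) : Function.update B x P z = ∅ := by
  rw [Finset.mem_insert, not_or] at hz
  rw [Function.update_of_ne hz.1]
  exact h.eq_empty z hz.2

theorem sum_card_update {x : α} (hx : x ∉ U) (P : Finset α) :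
    ∑ z ∈ insert x U, (Function.update B x P z).card = P.card + ∑ z ∈ U, (B z).card := by
  rw [Finset.sum_insert hx, Function.update_self]
  congr 1
  refine Finset.sum_congr rfl fun z hz => ?_
  rw [Function.update_of_ne (by rintro rfl; exact hx hz)]

/-- A growing orientation extends to a further vertex with `d` pairwise adjacent neighbours. -/
theorem extend (h : IsGrowth G d R U B r) (hd : 1 ≤ d) {x : α} (hx : x ∉ U) {κ : Finset α}
    (hκ : κ ⊆ nbrsIn G U x) (hκd : κ.card = d) (hκc : G.IsClique (κ : Set α)) :
    IsGrowth G d R (insert x U) (Function.update B x (nbrsIn G U x))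
      (Function.update r x (U.sup r + 1)) := by
  have hP : nbrsIn G U x ⊆ U := fun y hy => (mem_nbrsIn.1 hy).1
  have hne : ∀ {y}, y ∈ U → y ≠ x := by rintro y hy rfl; exact hx hy
  refine ⟨h.root_subset.trans (Finset.subset_insert _ _), h.update_subset x hP,
    h.update_eq_empty x, h.rank_update_lt hx hP, ?_, ?_, ?_, ?_, ?_⟩
  · intro z y hy
    by_cases hz : z = x
    · subst hz
      rw [Function.update_self] at hy
      exact (mem_nbrsIn.1 hy).2
    · rw [Function.update_of_ne hz] at hy
      exact h.adj z y hy
  · intro y hy z hz hyz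
    rw [Finset.mem_insert] at hy hz
    rcases hy with rfl | hy
    · rcases hz with rfl | hz
      · exact absurd hyz (G.loopless.irrefl _)
      · left
        rw [Function.update_self]
        exact mem_nbrsIn.2 ⟨hz, hyz⟩
    · rcases hz with rfl | hz
      · right
        rw [Function.update_self]
        exact mem_nbrsIn.2 ⟨hy, hyz.symm⟩
      · rw [Function.update_of_ne (hne hy), Function.update_of_ne (hne hz)]
        exact h.total y hy z hz hyz
  · intro z hz
    rw [Function.update_of_ne (hne (h.root_subset hz))]
    exact h.root_card z hz
  · intro z hz hzR
    rcases Finset.mem_insert.1 hz with rfl | hz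
    · rw [Function.update_self, ← hκd]
      exact Finset.card_le_card hκ
    · rw [Function.update_of_ne (hne hz)]
      exact h.le_card z hz hzR
  · intro z hz hzR hzd
    rcases Finset.mem_insert.1 hz with rfl | hz
    · rw [Function.update_self] at hzd ⊢
      have he : κ = nbrsIn G U z := Finset.eq_of_subset_of_card_le hκ (by omega)
      -- The back-neighbours form the clique `κ`; its latest vertex points to all the others.
      obtain ⟨y, hy, hmax⟩ := Finset.exists_max_image κ r (Finset.card_pos.1 (by omega))
      refine ⟨y, hκ hy, fun w hw => ?_⟩
      rw [Finset.mem_erase, ← he] at hw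
      have hyU := hP (hκ hy)
      rw [Function.update_of_ne (hne hyU)]
      rcases h.total y hyU w (hP (hκ hw.2)) (hκc hy hw.2 hw.1.symm) with h1 | h1
      · exact h1
      · exact absurd (h.rank_lt _ _ h1) (not_lt.2 (hmax w hw.2))
    · rw [Function.update_of_ne (hne hz)] at hzd ⊢
      obtain ⟨y, hy, hsub⟩ := h.parent z hz hzR hzd
      exact ⟨y, hy, by rwa [Function.update_of_ne (hne (h.subset z hy))]⟩

/-- The vertices outside `R` already use `d * U.card - d * (d + 1)` of the allowed edges, which
bounds the total excess. -/
theorem sum_card_sdiff (h : IsGrowth G d R U B r) (hR : R.card = d + 1)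
    (hsum : ∑ x ∈ U, (B x).card ≤ d * U.card) :
    ∑ x ∈ U \ R, ((B x).card - d) ≤ d * (d + 1) := by
  have h1 : ∑ x ∈ U \ R, (B x).card = ∑ x ∈ U \ R, ((B x).card - d) + d * (U \ R).card := by
    rw [mul_comm, ← smul_eq_mul, ← Finset.sum_const, ← Finset.sum_add_distrib]
    refine Finset.sum_congr rfl fun x hx => ?_
    rw [Finset.mem_sdiff] at hx
    have := h.le_card x hx.1 hx.2
    omega
  have h2 : ∑ x ∈ U \ R, (B x).card ≤ ∑ x ∈ U, (B x).card :=
    Finset.sum_le_sum_of_subset Finset.sdiff_subset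
  have h3 := Finset.card_sdiff_add_card_eq_card h.root_subset
  have h4 : d * U.card = d * (U \ R).card + d * (d + 1) := by
    rw [← h3, hR]; ring
  omega

theorem card_le (h : IsGrowth G d R U B r) (hR : R.card = d + 1)
    (hsum : ∑ x ∈ U, (B x).card ≤ d * U.card) (x : α) : (B x).card ≤ (d + 1) ^ 2 := by
  by_cases hx : x ∈ U
  · by_cases hxR : x ∈ R
    · have := h.root_card x hxR
      nlinarith
    · have h1 := Finset.single_le_sum (f := fun x => (B x).card - d) (fun _ _ => Nat.zero_le _)
        (Finset.mem_sdiff.2 ⟨hx, hxR⟩)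
      have h2 := h.sum_card_sdiff hR hsum
      have h3 : (B x).card ≤ d + d * (d + 1) := by
        omega
      nlinarith
  · simp [h.eq_empty x hx]

theorem exists_special (h : IsGrowth G d R U B r) (hR : R.card = d + 1)
    (hsum : ∑ x ∈ U, (B x).card ≤ d * U.card) :
    ∃ Z ⊆ U, Z.card ≤ (d + 1) ^ 2 ∧ ∀ x ∈ U, x ∉ Z → ∃ y ∈ B x, (B x).erase y ⊆ B y := by
  -- The root contributes `d + 1` vertices, and each other exceptional vertex uses at least one unit
  -- of the excess `d * (d + 1)`.
  refine ⟨R ∪ (U \ R).filter (fun x => (B x).card ≠ d), ?_, ?_, ?_⟩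
  · exact Finset.union_subset h.root_subset ((Finset.filter_subset _ _).trans Finset.sdiff_subset)
  · have h1 : ((U \ R).filter (fun x => (B x).card ≠ d)).card ≤
        ∑ x ∈ U \ R, ((B x).card - d) := by
      rw [Finset.card_filter]
      refine Finset.sum_le_sum fun x hx => ?_
      rw [Finset.mem_sdiff] at hx
      have := h.le_card x hx.1 hx.2
      split_ifs <;> omega
    have h2 := h.sum_card_sdiff hR hsum
    have h3 := Finset.card_union_le R ((U \ R).filter (fun x => (B x).card ≠ d))
    nlinarith
  · intro x hx hxZ
    simp only [Finset.mem_union, Finset.mem_filter, Finset.mem_sdiff, not_or, not_and, not_not]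
      at hxZ
    exact h.parent x hx hxZ.1 (hxZ.2 ⟨hx, hxZ.1⟩)

/-- If one further vertex makes the orientation exceed `d |U|` edges, then a part of it is a back
system. -/
theorem exists_isBackSystem_insert (h : IsGrowth G d R U B r) (hR : R.card = d + 1)
    (hsum : ∑ x ∈ U, (B x).card ≤ d * U.card) {x : α} (hx : x ∉ U)
    (hlt : d * (U.card + 1) < (nbrsIn G U x).card + ∑ z ∈ U, (B z).card) :
    ∃ V B', IsBackSystem d V B' ∧ ∀ z, ∀ y ∈ B' z, G.Adj z y := by
  have hlow : d * U.card ≤ ∑ x ∈ U, (B x).card + d * (d + 1) := by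
    have h1 : d * (U \ R).card ≤ ∑ x ∈ U \ R, (B x).card := by
      rw [mul_comm, ← smul_eq_mul, ← Finset.sum_const]
      refine Finset.sum_le_sum fun x hx => ?_
      rw [Finset.mem_sdiff] at hx
      exact h.le_card x hx.1 hx.2
    have h2 : ∑ x ∈ U \ R, (B x).card ≤ ∑ x ∈ U, (B x).card :=
      Finset.sum_le_sum_of_subset Finset.sdiff_subset
    have h3 := Finset.card_sdiff_add_card_eq_card h.root_subset
    have h4 : d * U.card = d * (U \ R).card + d * (d + 1) := by
      rw [← h3, hR]; ring
    omega
  -- Trim the edges at `x` so that the total is exactly one above `d` per vertex. The trimmed set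
  -- need not be a clique, so `x` becomes exceptional.
  obtain ⟨P, hPsub, hPcard⟩ := Finset.exists_subset_card_eq
    (show d * (U.card + 1) + 1 - ∑ z ∈ U, (B z).card ≤ (nbrsIn G U x).card by omega)
  have hPU : P ⊆ U := fun y hy => (mem_nbrsIn.1 (hPsub hy)).1
  have hne : ∀ {y}, y ∈ U → y ≠ x := by rintro y hy rfl; exact hx hy
  have hmul : d * (U.card + 1) = d * U.card + d := by ring
  obtain ⟨Z, hZU, hZc, hZ⟩ := h.exists_special hR hsum
  refine ⟨insert x U, Function.update B x P, ⟨h.update_subset x hPU, h.update_eq_empty x,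
    ⟨_, h.rank_update_lt hx hPU⟩, fun z => ?_, ⟨insert x Z, ?_, ?_, fun z hz hzZ => ?_⟩, ?_⟩,
    fun z y hy => ?_⟩
  · by_cases hz : z = x
    · subst hz
      rw [Function.update_self, hPcard]
      have : (d + 1) ^ 2 = d * (d + 1) + d + 1 := by ring
      omega
    · rw [Function.update_of_ne hz]
      exact h.card_le hR hsum z
  · exact Finset.insert_subset_insert _ hZU
  · exact (Finset.card_insert_le _ _).trans (by omega)
  · rw [Finset.mem_insert, not_or] at hzZ
    have hzU := (Finset.mem_insert.1 hz).resolve_left hzZ.1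
    obtain ⟨y, hy, hsub⟩ := hZ z hzU hzZ.2
    rw [Function.update_of_ne hzZ.1]
    exact ⟨y, hy, by rwa [Function.update_of_ne (hne (h.subset z hy))]⟩
  · rw [sum_card_update hx, hPcard, Finset.card_insert_of_notMem hx]
    omega
  · by_cases hz : z = x
    · subst hz
      rw [Function.update_self] at hy
      exact (mem_nbrsIn.1 (hPsub hy)).2
    · rw [Function.update_of_ne hz] at hy
      exact h.adj z y hy

/-- The sum of the degrees is at most twice the number of oriented edges. -/
theorem sum_card_nbrsIn_le (h : IsGrowth G d R U B r) :
    ∑ x ∈ U, (nbrsIn G U x).card ≤ 2 * ∑ x ∈ U, (B x).card := by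
  have h1 : ∑ x ∈ U, (U.filter fun y => x ∈ B y).card = ∑ y ∈ U, (B y).card := by
    have := Finset.sum_card_bipartiteAbove_eq_sum_card_bipartiteBelow (s := U) (t := U)
      (fun x y => x ∈ B y)
    simp only [Finset.bipartiteAbove, Finset.bipartiteBelow] at this
    rw [this]
    refine Finset.sum_congr rfl fun y _ => ?_
    congr 1
    ext x
    simpa using @h.subset y x
  rw [two_mul]
  nth_rewrite 2 [← h1]
  rw [← Finset.sum_add_distrib]
  refine Finset.sum_le_sum fun x hx => ?_
  refine (Finset.card_le_card fun y hy => ?_).trans (Finset.card_union_le _ _)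
  rw [mem_nbrsIn] at hy
  rcases h.total x hx y hy.1 hy.2 with h2 | h2
  · exact Finset.mem_union_left _ h2
  · exact Finset.mem_union_right _ (Finset.mem_filter.2 ⟨hy.1, h2⟩)

end IsGrowth

/-- A vertex set containing one but not all members of a strongly connected set of cliques has `d`
pairwise adjacent elements with a common neighbour outside. -/
theorem StronglyConnected.exists_extension {G : SimpleGraph α} {d : ℕ} {S : Finset (Finset α)}
    (hS : ∀ s ∈ S, s.card = d + 1 ∧ G.IsClique (s : Set α)) (hconn : StronglyConnected d S)
    {R U : Finset α} (hR : R ∈ S) (hRU : R ⊆ U) (hne : ¬ vertices S ⊆ U) :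
    ∃ x ∈ vertices S, x ∉ U ∧
      ∃ κ ⊆ nbrsIn G U x, κ.card = d ∧ G.IsClique (κ : Set α) := by
  obtain ⟨z, hz, hzU⟩ := Finset.not_subset.1 hne
  obtain ⟨t, ht, hzt⟩ := mem_vertices.1 hz
  have key : ∀ t, Relation.ReflTransGen (fun a b => b ∈ S ∧ (a ∩ b).card = d) R t →
      t ⊆ U ∨ ∃ a b, a ⊆ U ∧ ¬ b ⊆ U ∧ b ∈ S ∧ (a ∩ b).card = d := by
    intro t h
    induction h with
    | refl => exact Or.inl hRU
    | @tail a b _ h ih =>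
      rcases ih with h1 | h1
      · by_cases h2 : b ⊆ U
        · exact Or.inl h2
        · exact Or.inr ⟨a, b, h1, h2, h.1, h.2⟩
      · exact Or.inr h1
  rcases key t (hconn R hR t ht) with h1 | ⟨a, b, ha, hb, hbS, hab⟩
  · exact absurd (h1 hzt) hzU
  obtain ⟨x, hx, hxU⟩ := Finset.not_subset.1 hb
  refine ⟨x, mem_vertices.2 ⟨b, hbS, hx⟩, hxU, a ∩ b, fun y hy => ?_, hab,
    (hS b hbS).2.subset (by simp)⟩
  rw [Finset.mem_inter] at hy
  exact mem_nbrsIn.2 ⟨ha hy.1, (hS b hbS).2 hx hy.2 (by rintro rfl; exact hxU (ha hy.1))⟩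

/-- A graph that is not sparse contains a back system. -/
theorem exists_isBackSystem_of_not_isSparse [Fintype α] {G : SimpleGraph α} {d : ℕ} (hd : 1 ≤ d)
    (hG : ¬ IsSparse G d) : ∃ V B, IsBackSystem d V B ∧ ∀ x, ∀ y ∈ B x, G.Adj x y := by
  simp only [IsSparse, not_forall, not_le] at hG
  obtain ⟨S, ⟨R, hR⟩, hS, hconn, hlt⟩ := hG
  have key : ∀ n U B r, (vertices S \ U).card = n → IsGrowth G d R U B r → U ⊆ vertices S →
      ∑ x ∈ U, (B x).card ≤ d * U.card →
      ∃ V B, IsBackSystem d V B ∧ ∀ x, ∀ y ∈ B x, G.Adj x y := by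
    intro n
    induction n using Nat.strong_induction_on with
    | _ n ih =>
    intro U B r hn hgrow hU hsum
    -- Covering all vertices within the edge bound would contradict the large degree sum of `S`, so
    -- the bound is exceeded earlier.
    have hne : ¬ vertices S ⊆ U := fun h => by
      have he := Finset.Subset.antisymm hU h
      have := hgrow.sum_card_nbrsIn_le
      rw [he] at this hsum
      nlinarith
    obtain ⟨x, hx, hxU, κ, hκ, hκd, hκc⟩ := hconn.exists_extension hS hR hgrow.root_subset hne
    by_cases hle : d * (U.card + 1) < (nbrsIn G U x).card + ∑ z ∈ U, (B z).card
    · exact hgrow.exists_isBackSystem_insert (hS R hR).1 hsum hxU hle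
    · refine ih _ ?_ _ _ _ rfl (hgrow.extend hd hxU hκ hκd hκc)
        (Finset.insert_subset hx hU) ?_
      · rw [← hn]
        refine Finset.card_lt_card ⟨Finset.sdiff_subset_sdiff subset_rfl
          (Finset.subset_insert _ _), fun h => ?_⟩
        have := h (Finset.mem_sdiff.2 ⟨hx, hxU⟩)
        simp at this
      · rw [IsGrowth.sum_card_update hxU, Finset.card_insert_of_notMem hxU]
        omega
  obtain ⟨B, r, hgrow⟩ := exists_isGrowth_of_isClique (hS R hR).1 (hS R hR).2
  refine key _ R B r rfl hgrow (fun x hx => mem_vertices.2 ⟨R, hR, hx⟩) ?_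
  refine (Finset.sum_le_card_nsmul _ _ d hgrow.root_card).trans ?_
  rw [smul_eq_mul, mul_comm]

end RandomFlag

/-! ### Counting back systems and the first moment bound. -/

namespace RandomFlag

open MeasureTheory unitInterval in
/-- The probability that the binomial random graph contains given edges. -/
theorem binomialRandom_subset_edgeSet_le {V : Type*} [Countable V] (p : unitInterval)
    (E : Finset (Sym2 V)) :
    SimpleGraph.binomialRandom V p {G | (E : Set (Sym2 V)) ⊆ G.edgeSet} ≤
      (toNNReal p : ENNReal) ^ E.card := by
  rw [SimpleGraph.binomialRandom_apply]
  refine (measure_mono (t := Set.pi E (fun _ => {True})) ?_).trans ?_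
  · rintro _ ⟨G, hG, rfl⟩ e he
    simpa using hG he
  · rw [Measure.infinitePi_pi _ (fun _ _ => MeasurableSet.of_discrete)]
    refine Finset.prod_le_pow_card _ _ _ fun e _ => ?_
    by_cases he : e.IsDiag <;> simp [he]

/-- The subsets of a set with at most `M` elements can be indexed by the subsets of `Fin M`. -/
theorem exists_selector (α : Type*) (M : ℕ) :
    ∃ sel : Finset (Fin M) → Finset α → Finset α,
      ∀ T : Finset α, T.card ≤ M → ∀ K ⊆ T, ∃ A, sel A T = K := by
  classical
  refine ⟨fun A T => T.filter fun y => ∃ h : y ∈ T, ∃ j ∈ A, (j : ℕ) = T.equivFin ⟨y, h⟩, ?_⟩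
  intro T hT K hK
  refine ⟨Finset.univ.filter fun j : Fin M => ∃ y, ∃ h : y ∈ T, y ∈ K ∧ (j : ℕ) = T.equivFin ⟨y, h⟩,
    ?_⟩
  ext y
  simp only [Finset.mem_filter, Finset.mem_univ, true_and]
  constructor
  · rintro ⟨-, h, j, ⟨y', h', hy', hj⟩, hj'⟩
    have := T.equivFin.injective (Fin.ext (hj.symm.trans hj'))
    rw [Subtype.mk.injEq] at this
    exact this ▸ hy'
  · intro hy
    exact ⟨hK hy, hK hy, ⟨T.equivFin ⟨y, hK hy⟩, (T.equivFin ⟨y, hK hy⟩).2.trans_le hT⟩,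
      ⟨y, hK hy, hy, rfl⟩, rfl⟩

/-- A finite set with at most `M` elements is listed by a partial function on `Fin M`. -/
theorem exists_listing {α : Type*} {V T : Finset α} (hTV : T ⊆ V) {M : ℕ} (hT : T.card ≤ M) :
    ∃ l : Fin M → Option V, ∀ y, y ∈ T ↔ ∃ j, (l j).map Subtype.val = some y := by
  refine ⟨fun j => if h : (j : ℕ) < T.card then
    some ⟨T.equivFin.symm ⟨j, h⟩, hTV (T.equivFin.symm ⟨j, h⟩).2⟩ else none, fun y => ?_⟩
  constructor
  · intro hy
    refine ⟨⟨T.equivFin ⟨y, hy⟩, (T.equivFin ⟨y, hy⟩).2.trans_le hT⟩, ?_⟩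
    simp
  · rintro ⟨j, hj⟩
    dsimp only at hj
    split_ifs at hj with h
    · simp only [Option.map_some, Option.some.injEq] at hj
      rw [← hj]
      exact (T.equivFin.symm ⟨j, h⟩).2
    · simp at hj

variable {α : Type*} [DecidableEq α]

open unitInterval in
-- Acyclicity prevents an edge from being counted in both directions, so the required edges are
-- distinct.
theorem IsBackSystem.binomialRandom_le [Fintype α] {d : ℕ} {V : Finset α} {B : α → Finset α}
    (h : IsBackSystem d V B) (p : unitInterval) :
    SimpleGraph.binomialRandom α p {G | ∀ x, ∀ y ∈ B x, G.Adj x y} ≤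
      (toNNReal p : ENNReal) ^ (d * V.card + 1) := by
  obtain ⟨r, hr⟩ := h.acyclic
  have hcard : ((V.sigma B).image fun q => s(q.1, q.2)).card = d * V.card + 1 := by
    rw [Finset.card_image_of_injOn, Finset.card_sigma, h.sum_card]
    rintro ⟨x, y⟩ hxy ⟨x', y'⟩ hxy' he
    simp only [Finset.coe_sigma, Set.mem_sigma_iff, Finset.mem_coe] at hxy hxy'
    simp only [Sym2.eq_iff] at he
    rcases he with ⟨rfl, rfl⟩ | ⟨rfl, rfl⟩
    · rfl
    · exact absurd (hr _ _ hxy.2) (hr _ _ hxy'.2).not_gt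
  rw [← hcard]
  refine le_trans (MeasureTheory.measure_mono fun G hG => ?_)
    (binomialRandom_subset_edgeSet_le p _)
  intro e he
  obtain ⟨⟨x, y⟩, hq, rfl⟩ := Finset.mem_image.1 he
  exact hG x y (Finset.mem_sigma.1 hq).2

open Classical in
/-- The number of back systems on a given vertex set. -/
theorem card_isBackSystem_le [Fintype α] (d : ℕ) (V : Finset α) :
    (Finset.univ.filter (IsBackSystem d V)).card ≤
      (V.card * (V.card + 1) ^ (d + 1) ^ 2) ^ ((d + 1) ^ 2 + 1) *
        (V.card * 2 ^ (d + 1) ^ 2) ^ V.card := by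
  set M := (d + 1) ^ 2 with hM
  obtain ⟨sel, hsel⟩ := exists_selector α M
  -- The `M + 1` slots name vertices, covering the exceptional ones, and list their out-neighbours.
  -- Any other vertex records its parent and a pattern selecting the rest from the parent's
  -- out-neighbours.
  let Decodes : ((Fin (M + 1) → V × (Fin M → Option V)) × (V → V × Finset (Fin M))) →
      (α → Finset α) → Prop := fun c B =>
    (∀ i y, y ∈ B (c.1 i).1 ↔ ∃ j, ((c.1 i).2 j).map Subtype.val = some y) ∧
    ∀ x : V, (∀ i, (c.1 i).1 ≠ x) → ((c.2 x).1 : α) ∈ B x ∧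
      B x = insert ((c.2 x).1 : α) (sel (c.2 x).2 (B (c.2 x).1))
  have hex : ∀ B, IsBackSystem d V B → ∃ c, Decodes c B := by
    intro B hB
    obtain ⟨Z, hZV, hZc, hZ⟩ := hB.parent
    have hVne : V.Nonempty := by
      rw [Finset.nonempty_iff_ne_empty]
      rintro rfl
      simpa using hB.sum_card
    have hl : ∃ e : Fin (M + 1) → V, ∀ x ∈ Z, ∃ i, (e i : α) = x := by
      obtain ⟨l, hl⟩ := exists_listing hZV hZc
      refine ⟨fun i => (l i).getD ⟨hVne.choose, hVne.choose_spec⟩, fun x hx => ?_⟩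
      obtain ⟨i, hi⟩ := (hl x).1 hx
      obtain ⟨w, hw, rfl⟩ := Option.map_eq_some_iff.1 hi
      exact ⟨i, by simp [hw]⟩
    obtain ⟨e, he⟩ := hl
    choose g hg using fun x => exists_listing (hB.subset x) (hB.card_le x)
    have hpar : ∀ x : V, ∃ q : V × Finset (Fin M), (∀ i, e i ≠ x) → (q.1 : α) ∈ B x ∧
        B x = insert (q.1 : α) (sel q.2 (B q.1)) := by
      intro x
      by_cases hx : ∀ i, e i ≠ x
      · have hxZ : (x : α) ∉ Z := fun hxZ => by
          obtain ⟨i, hi⟩ := he x hxZ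
          exact hx i (Subtype.ext hi)
        obtain ⟨y, hy, hsub⟩ := hZ x x.2 hxZ
        obtain ⟨A, hA⟩ := hsel (B y) (hB.card_le y) _ hsub
        refine ⟨(⟨y, hB.subset x hy⟩, A), fun _ => ⟨hy, ?_⟩⟩
        simp only
        rw [hA, Finset.insert_erase hy]
      · exact ⟨(x, ∅), fun h => absurd h hx⟩
    choose q hq using hpar
    exact ⟨(fun i => (e i, g (e i)), q), fun i y => hg (e i) y, fun x hx => hq x hx⟩
  have huniq : ∀ c B B', IsBackSystem d V B → IsBackSystem d V B' → Decodes c B → Decodes c B' →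
      B = B' := by
    intro c B B' hB hB' hc hc'
    obtain ⟨r, hr⟩ := hB.acyclic
    -- Decode by increasing rank: the parent has smaller rank, so its out-neighbours are already
    -- known.
    have key : ∀ n x, r x = n → B x = B' x := by
      intro n
      induction n using Nat.strong_induction_on with
      | _ n ih =>
      intro x hx
      by_cases hxV : x ∈ V
      · by_cases hspec : ∃ i, (c.1 i).1 = (⟨x, hxV⟩ : V)
        · obtain ⟨i, hi⟩ := hspec
          ext y
          have h1 := hc.1 i y
          have h2 := hc'.1 i y
          rw [hi] at h1 h2
          exact h1.trans h2.symm
        · push Not at hspec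
          obtain ⟨h1, h2⟩ := hc.2 ⟨x, hxV⟩ hspec
          obtain ⟨-, h3⟩ := hc'.2 ⟨x, hxV⟩ hspec
          have h4 := ih _ (hx ▸ hr _ _ h1) _ rfl
          simp only at h2 h3
          rw [h2, h3, h4]
      · rw [hB.eq_empty x hxV, hB'.eq_empty x hxV]
    exact funext fun x => key _ x rfl
  rcases (Finset.univ.filter (IsBackSystem d V)).eq_empty_or_nonempty with he | ⟨B₀, hB₀⟩
  · simp [he]
  have : Nonempty ((Fin (M + 1) → V × (Fin M → Option V)) × (V → V × Finset (Fin M))) :=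
    (hex B₀ (Finset.mem_filter.1 hB₀).2).nonempty
  choose! code hcode using hex
  have hle := Finset.card_le_card_of_injOn (s := Finset.univ.filter (IsBackSystem d V))
    (t := Finset.univ) code (fun _ _ => Finset.mem_coe.2 (Finset.mem_univ _)) (by
      intro B hB B' hB' he
      simp only [Finset.coe_filter, Finset.mem_univ, true_and, Set.mem_ofPred_eq] at hB hB'
      exact huniq _ B B' hB hB' (hcode B hB) (he ▸ hcode B' hB'))
  refine hle.trans (le_of_eq ?_)
  simp

/-- The polynomially growing factor in the number of back systems on `m` vertices. -/
def exceptionalFactor (d m : ℕ) : ℕ := (m * (m + 1) ^ (d + 1) ^ 2) ^ ((d + 1) ^ 2 + 1)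

open unitInterval in
/-- The first moment bound for the probability that the random graph contains a back system. -/
theorem binomialRandom_not_isSparse_le [Fintype α] {d : ℕ} (hd : 1 ≤ d) (p : unitInterval) :
    SimpleGraph.binomialRandom α p {G | ¬ IsSparse G d} ≤
      ∑ m ∈ Finset.range (Fintype.card α + 1),
        ((Fintype.card α).choose m * (exceptionalFactor d m * (m * 2 ^ (d + 1) ^ 2) ^ m) : ℕ) *
          (toNNReal p : ENNReal) ^ (d * m + 1) := by
  classical
  have hsub : {G : SimpleGraph α | ¬ IsSparse G d} ⊆
      ⋃ V ∈ (Finset.univ : Finset (Finset α)),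
        ⋃ B ∈ Finset.univ.filter (IsBackSystem d V), {G | ∀ x, ∀ y ∈ B x, G.Adj x y} := by
    intro G hG
    obtain ⟨V, B, hB, hadj⟩ := exists_isBackSystem_of_not_isSparse hd hG
    simp only [Set.mem_iUnion]
    exact ⟨V, Finset.mem_univ _, B, Finset.mem_filter.2 ⟨Finset.mem_univ _, hB⟩, hadj⟩
  refine (MeasureTheory.measure_mono hsub).trans ?_
  refine (MeasureTheory.measure_biUnion_finset_le _ _).trans ?_
  have h1 : ∀ V : Finset α, SimpleGraph.binomialRandom α p
      (⋃ B ∈ Finset.univ.filter (IsBackSystem d V), {G | ∀ x, ∀ y ∈ B x, G.Adj x y}) ≤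
      ((exceptionalFactor d V.card * (V.card * 2 ^ (d + 1) ^ 2) ^ V.card : ℕ) : ENNReal) *
        (toNNReal p : ENNReal) ^ (d * V.card + 1) := by
    intro V
    refine (MeasureTheory.measure_biUnion_finset_le _ _).trans ?_
    refine (Finset.sum_le_card_nsmul _ _ _ fun B hB =>
      (Finset.mem_filter.1 hB).2.binomialRandom_le p).trans ?_
    rw [nsmul_eq_mul]
    gcongr
    exact card_isBackSystem_le d V
  refine (Finset.sum_le_sum fun V _ => h1 V).trans (le_of_eq ?_)
  rw [← Finset.powerset_univ, Finset.sum_powerset_apply_card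
    (fun m => ((exceptionalFactor d m * (m * 2 ^ (d + 1) ^ 2) ^ m : ℕ) : ENNReal) *
        (toNNReal p : ENNReal) ^ (d * m + 1)), Finset.card_univ]
  refine Finset.sum_congr rfl fun m _ => ?_
  rw [nsmul_eq_mul, Nat.cast_mul ((Fintype.card α).choose m), mul_assoc]

/-- The growth rate in the first moment bound is less than one. -/
theorem exp_mul_pow_lt_one {d : ℕ} (hd : 2 ≤ d) {c : ℝ} (hc0 : 0 ≤ c)
    (hc : c < 1 / (2 ^ (2 * d + 1) * (d : ℝ))) :
    Real.exp 1 * 2 ^ (d + 1) ^ 2 * c ^ d < 1 := by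
  have hd' : (2 : ℝ) ≤ d := by exact_mod_cast hd
  -- The factor `d ≥ 2` in the bound on `c` supplies one more power of two.
  have hc1 : c ≤ (1 / 2) ^ (2 * d + 2) := by
    refine hc.le.trans ?_
    rw [div_pow, one_pow]
    refine one_div_le_one_div_of_le (by positivity) ?_
    rw [pow_succ (2 : ℝ) (2 * d + 1)]
    gcongr
  have h1 : c ^ d ≤ (1 / 2) ^ ((2 * d + 2) * d) := by
    rw [pow_mul]
    gcongr
  have h2 : Real.exp 1 < 2 ^ 2 := by
    have := Real.exp_one_lt_d9
    norm_num at this ⊢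
    linarith
  -- Equivalent to `3 ≤ d ^ 2`; the summand `2` pays for `e < 2 ^ 2`.
  have h3 : (d + 1) ^ 2 + 2 ≤ (2 * d + 2) * d := by nlinarith
  calc Real.exp 1 * 2 ^ (d + 1) ^ 2 * c ^ d
      ≤ Real.exp 1 * 2 ^ (d + 1) ^ 2 * (1 / 2) ^ ((2 * d + 2) * d) := by gcongr
    _ < 2 ^ 2 * 2 ^ (d + 1) ^ 2 * (1 / 2) ^ ((2 * d + 2) * d) := by gcongr
    _ ≤ 2 ^ 2 * 2 ^ (d + 1) ^ 2 * (1 / 2) ^ ((d + 1) ^ 2 + 2) := by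
      gcongr ?_ * ?_
      exact pow_le_pow_of_le_one (by norm_num) (by norm_num) h3
    _ = 1 := by
      rw [div_pow, one_pow, pow_add]
      field_simp

/-- The factor `m ^ m` counts the choices of parents; the `m!` in the binomial coefficient reduces
it to `e ^ m`. -/
theorem choose_mul_pow_le (n m : ℕ) : ((n.choose m : ℝ) * m ^ m) ≤ (n * Real.exp 1) ^ m := by
  calc ((n.choose m : ℝ) * m ^ m) ≤ (n ^ m / m.factorial) * m ^ m := by
        gcongr
        exact Nat.choose_le_pow_div m n
    _ = n ^ m * (m ^ m / m.factorial) := by ring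
    _ ≤ n ^ m * Real.exp m := by
        gcongr
        exact Real.pow_div_factorial_le_exp _ (by positivity) m
    _ = (n * Real.exp 1) ^ m := by
        rw [mul_pow, ← Real.exp_nat_mul, mul_one]

/-- A single term of the first moment bound. -/
theorem first_moment_term_le {d : ℕ} (n m : ℕ) {c p : ℝ} (hp0 : 0 ≤ p) (hp : n * p ^ d ≤ c ^ d) :
    ((n.choose m * (exceptionalFactor d m * (m * 2 ^ (d + 1) ^ 2) ^ m) : ℕ) : ℝ) *
      p ^ (d * m + 1) ≤
    p * (exceptionalFactor d m * (Real.exp 1 * 2 ^ (d + 1) ^ 2 * c ^ d) ^ m) := by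
  have h1 := choose_mul_pow_le n m
  calc ((n.choose m * (exceptionalFactor d m * (m * 2 ^ (d + 1) ^ 2) ^ m) : ℕ) : ℝ) *
      p ^ (d * m + 1)
      = (n.choose m * m ^ m) * (p * exceptionalFactor d m * (2 ^ (d + 1) ^ 2) ^ m * (p ^ d) ^ m) := by
        push_cast
        rw [mul_pow, pow_succ, pow_mul]
        ring
    _ ≤ (n * Real.exp 1) ^ m *
        (p * exceptionalFactor d m * (2 ^ (d + 1) ^ 2) ^ m * (p ^ d) ^ m) := by gcongr
    _ = p * exceptionalFactor d m * (Real.exp 1 * 2 ^ (d + 1) ^ 2 * (n * p ^ d)) ^ m := by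
        simp only [mul_pow]
        ring
    _ ≤ p * exceptionalFactor d m * (Real.exp 1 * 2 ^ (d + 1) ^ 2 * c ^ d) ^ m := by gcongr
    _ = _ := by ring

theorem mul_pow_pow_le (m a : ℕ) {b : ℕ} (hb : b ≠ 0) :
    (m * (m + 1) ^ a) ^ b ≤ (2 * m) ^ ((1 + a) * b) := by
  rcases Nat.eq_zero_or_pos m with rfl | hm
  · simp [hb]
  · have h1 : (m + 1) ^ a ≤ (2 * m) ^ a := Nat.pow_le_pow_left (by omega) a
    have h2 : m * (m + 1) ^ a ≤ (2 * m) ^ (1 + a) := by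
      rw [pow_add (2 * m) 1 a, pow_one]
      exact Nat.mul_le_mul (by omega) h1
    calc (m * (m + 1) ^ a) ^ b ≤ ((2 * m) ^ (1 + a)) ^ b := Nat.pow_le_pow_left h2 b
      _ = (2 * m) ^ ((1 + a) * b) := (pow_mul _ _ _).symm

theorem summable_exceptionalFactor (d : ℕ) {q : ℝ} (hq0 : 0 ≤ q) (hq : q < 1) :
    Summable fun m : ℕ => (exceptionalFactor d m : ℝ) * q ^ m := by
  obtain ⟨K, hK⟩ : ∃ K, ∀ m, exceptionalFactor d m ≤ (2 * m) ^ K :=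
    ⟨_, fun m => mul_pow_pow_le m ((d + 1) ^ 2) (b := (d + 1) ^ 2 + 1) (by positivity)⟩
  have hq' : ‖q‖ < 1 := by rwa [Real.norm_of_nonneg hq0]
  have h1 : Summable fun m : ℕ => (m : ℝ) ^ K * q ^ m :=
    summable_pow_mul_geometric_of_norm_lt_one K hq'
  refine Summable.of_nonneg_of_le (fun m => by positivity) (fun m => ?_)
    (h1.mul_left ((2 : ℝ) ^ K))
  rw [← mul_assoc, ← mul_pow]
  refine mul_le_mul_of_nonneg_right ?_ (by positivity)
  exact_mod_cast hK m

/-- Equality holds for `n ≠ 0`; the inequality accommodates `n = 0`. -/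
theorem natCast_mul_edgeProb_pow_le {d : ℕ} (hd : d ≠ 0) {c : ℝ} (hc0 : 0 ≤ c) (hc1 : c ≤ 1)
    (n : ℕ) : n * (edgeProb d c n : ℝ) ^ d ≤ c ^ d := by
  rcases Nat.eq_zero_or_pos n with rfl | hn
  · simpa using pow_nonneg hc0 d
  · have hn' : (n : ℝ) ≠ 0 := by positivity
    rw [coe_edgeProb d hc0 hc1, div_pow, ← Real.rpow_mul_natCast (by positivity),
      one_div_mul_cancel (by exact_mod_cast hd), Real.rpow_one, mul_div_cancel₀ _ hn']

theorem tendsto_edgeProb {d : ℕ} (hd : d ≠ 0) {c : ℝ} (hc0 : 0 ≤ c) (hc1 : c ≤ 1) :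
    Tendsto (fun n => (edgeProb d c n : ℝ)) atTop (𝓝 0) := by
  simp only [coe_edgeProb d hc0 hc1]
  refine Tendsto.const_div_atTop ?_ c
  exact (tendsto_rpow_atTop (by positivity)).comp tendsto_natCast_atTop_atTop

/-- In the subcritical range the random graph is sparse up to a probability of order `p`. -/
theorem binomialRandom_not_isSparse_le_tsum {d : ℕ} (hd : 2 ≤ d) {c : ℝ} (hc0 : 0 ≤ c)
    (hc : c < 1 / (2 ^ (2 * d + 1) * (d : ℝ))) (hc1 : c ≤ 1) (n : ℕ) :
    SimpleGraph.binomialRandom (Fin n) (edgeProb d c n) {G | ¬ IsSparse G d} ≤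
      ENNReal.ofReal (edgeProb d c n * ∑' m : ℕ, (exceptionalFactor d m : ℝ) *
        (Real.exp 1 * 2 ^ (d + 1) ^ 2 * c ^ d) ^ m) := by
  have hsum := summable_exceptionalFactor d (by positivity) (exp_mul_pow_lt_one hd hc0 hc)
  have hp0 : 0 ≤ (edgeProb d c n : ℝ) := (edgeProb d c n).2.1
  refine (binomialRandom_not_isSparse_le (by omega) _).trans ?_
  rw [Fintype.card_fin]
  have hterm : ∀ m, ((n.choose m * (exceptionalFactor d m * (m * 2 ^ (d + 1) ^ 2) ^ m) : ℕ) :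
      ENNReal) * (unitInterval.toNNReal (edgeProb d c n) : ENNReal) ^ (d * m + 1) =
      ENNReal.ofReal (((n.choose m * (exceptionalFactor d m * (m * 2 ^ (d + 1) ^ 2) ^ m) : ℕ) : ℝ) *
        (edgeProb d c n : ℝ) ^ (d * m + 1)) := by
    intro m
    rw [ENNReal.ofReal_mul (Nat.cast_nonneg _), ENNReal.ofReal_natCast, ENNReal.ofReal_pow hp0,
      ← unitInterval.coe_toNNReal, ENNReal.ofReal_coe_nnreal]
  rw [Finset.sum_congr rfl fun m _ => hterm m,
    ← ENNReal.ofReal_sum_of_nonneg fun m _ => by positivity]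
  refine ENNReal.ofReal_le_ofReal ?_
  refine (Finset.sum_le_sum fun m _ => first_moment_term_le n m hp0
    (natCast_mul_edgeProb_pow_le (by omega) hc0 hc1 n)).trans ?_
  rw [← Finset.mul_sum]
  refine mul_le_mul_of_nonneg_left ?_ hp0
  exact hsum.sum_le_tsum _ fun m _ => by positivity

end RandomFlag

theorem theorem2p1 (d : ℕ) (hd : 2 ≤ d) (c : ℝ) (hc0 : 0 ≤ c)
    (hc : c < 1 / (2 ^ (2 * d + 1) * (d : ℝ))) :
    Tendsto
      (fun n : ℕ => SimpleGraph.binomialRandom (Fin n) (RandomFlag.edgeProb d c n)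
        {G | RandomFlag.AlmostCollapsible d (RandomFlag.cliqueComplex G)})
      atTop (𝓝 1) := by
  have hc1 : c ≤ 1 := by
    have hd' : (1 : ℝ) ≤ d := by exact_mod_cast (by omega : 1 ≤ d)
    refine hc.le.trans (div_le_one_of_le₀ ?_ (by positivity))
    exact one_le_mul_of_one_le_of_one_le (one_le_pow₀ (by norm_num)) hd'
  set C := ∑' m : ℕ, (RandomFlag.exceptionalFactor d m : ℝ) *
    (Real.exp 1 * 2 ^ (d + 1) ^ 2 * c ^ d) ^ m
  have hlim : Tendsto (fun n : ℕ => 1 - ENNReal.ofReal (RandomFlag.edgeProb d c n * C)) atTop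
      (𝓝 1) := by
    have h1 := (RandomFlag.tendsto_edgeProb (d := d) (by omega) hc0 hc1).mul_const C
    have h2 := ENNReal.Tendsto.sub (tendsto_const_nhds (x := (1 : ENNReal)))
      (ENNReal.tendsto_ofReal h1) (Or.inl ENNReal.one_ne_top)
    simpa using h2
  refine tendsto_of_tendsto_of_tendsto_of_le_of_le hlim tendsto_const_nhds (fun n => ?_)
    (fun n => MeasureTheory.prob_le_one)
  have hbad := RandomFlag.binomialRandom_not_isSparse_le_tsum hd hc0 hc hc1 n
  refine tsub_le_iff_right.2 (le_trans ?_ (add_le_add_right hbad _))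
  -- Subadditivity bounds the total mass by the two events, without any measurability.
  rw [← MeasureTheory.measure_univ (μ := SimpleGraph.binomialRandom (Fin n)
    (RandomFlag.edgeProb d c n))]
  refine (MeasureTheory.measure_mono fun G _ => ?_).trans (MeasureTheory.measure_union_le _ _)
  by_cases hG : RandomFlag.IsSparse G d
  · exact Or.inl (hG.almostCollapsible hd)
  · exact Or.inr hG
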